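/- Let $n,m\ge 1$ be integers and $\alpha>0$. A smooth function $f\colon\mathbb{C}^n\to\mathbb{C}$ is called $m$-analytic if $\overline{D}^k f=0$ for every multi-index $k\in\mathbb{N}_0^n$ with $|k|=k_1+\dots+k_n=m$, where $\overline{D}^k=\prod_{r=1}^n(\partial/\partial\overline{z}_r)^{k_r}$. Let $\mathcal{F}_{\alpha,m}$ be the space of all $m$-analytic functions on $\mathbb{C}^n$ that are square integrable with respect to $\frac{\alpha^n}{\pi^n}e^{-\alpha|z|^2}\,dz$ ($dz$ is Lebesgue measure on $\mathbb{C}^n$). For $f\in\mathcal{F}_{\alpha,m}$ and $x,y\in\mathbb{R}^n$ put $$(Uf)(x,y)=2^{n/2}\,e^{-\frac12|x|^2-\frac12|y|^2-\mathrm{i}\langle x,y\rangle}\,f\!\left(\frac{x+\mathrm{i}y}{\sqrt{\alpha}}\right),$$ and let $\mathcal{H}_m=\{Uf\colon f\in\mathcal{F}_{\alpha,m}\}$ with the inner product and norm of $L^2(\mathbb{R}^{2n},(2\pi)^{-n}\,dx\,dy)$. Then $\mathcal{H}_m$ is a reproducing kernel Hilbert space of functions on $\mathbb{R}^{2n}$,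 i.e. it is complete and every point evaluation is a bounded functional. Its reproducing kernel is $$K_{x,y}(u,v)=2^n\,e^{-\frac12(|u-x|^2+|v-y|^2)-\mathrm{i}\langle u-x,\,v+y\rangle}\,L_{m-1}^{(n)}\bigl(|u-x|^2+|v-y|^2\bigr)\qquad(x,y,u,v\in\mathbb{R}^n),$$ where $L_p^{(n)}(t)=\sum_{i=0}^p(-1)^i\binom{p+n}{p-i}\frac{t^i}{i!}$ is the generalized Laguerre polynomial. For all $x,y\in\mathbb{R}^n$ the norm of the kernel is $$\|K_{x,y}\|_{\mathcal{H}_m}=\sqrt{2^n d_{n,m}},\qquad d_{n,m}=\#\{k\in\mathbb{N}_0^n\colon|k|\le m-1\}=\binom{n+m-1}{n}.$$ In particular, the kernel is invariant under horizontal translations: $K_{x+a,y}(u+a,v)=K_{x,y}(u,v)$ for all $a,x,y,u,v\in\mathbb{R}^n$. -/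

import Mathlib

open MeasureTheory
open scoped ContDiff

noncomputable section

namespace PolyFock

/-- The Wirtinger operator `∂/∂z̄_r = (∂/∂x_r + i ∂/∂y_r) / 2` on functions `ℂⁿ → ℂ`. -/
def dbar {n : ℕ} (r : Fin n) (f : (Fin n → ℂ) → ℂ) : (Fin n → ℂ) → ℂ := fun z =>
  (1 / 2 : ℂ) * (fderiv ℝ f z (Pi.single r 1) + Complex.I * fderiv ℝ f z (Pi.single r Complex.I))

/-- The operator `D̄ᵏ = ∏_r (∂/∂z̄_r)^{k_r}` for a multi-index `k`. -/
def dbarPow {n : ℕ} (k : Fin n → ℕ) (f : (Fin n → ℂ) → ℂ) : (Fin n → ℂ) → ℂ :=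
  (List.finRange n).foldr (fun r g => (dbar r)^[k r] g) f

/-- (Homogeneously) `m`-analytic functions: smooth functions with `D̄ᵏ f = 0` for all `|k| = m`. -/
def IsPolyanalytic {n : ℕ} (m : ℕ) (f : (Fin n → ℂ) → ℂ) : Prop :=
  ContDiff ℝ ∞ f ∧ ∀ k : Fin n → ℕ, ∑ r, k r = m → dbarPow k f = 0

lemma contDiff_dbar {n : ℕ} (r : Fin n) {f : (Fin n → ℂ) → ℂ} (hf : ContDiff ℝ ∞ f) :
    ContDiff ℝ ∞ (dbar r f) := by
  have h : ContDiff ℝ ∞ (fderiv ℝ f) := hf.fderiv_right (m := ∞) (by simp)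
  unfold dbar
  fun_prop

lemma dbar_add {n : ℕ} (r : Fin n) {f g : (Fin n → ℂ) → ℂ} (hf : ContDiff ℝ ∞ f)
    (hg : ContDiff ℝ ∞ g) : dbar r (f + g) = dbar r f + dbar r g := by
  funext z
  have h1 := (hf.differentiable (by simp)) z
  have h2 := (hg.differentiable (by simp)) z
  simp only [dbar, fderiv_add h1 h2, Pi.add_apply, add_apply]
  ring

lemma dbar_smul {n : ℕ} (r : Fin n) (c : ℂ) {f : (Fin n → ℂ) → ℂ} (hf : ContDiff ℝ ∞ f) :
    dbar r (c • f) = c • dbar r f := by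
  funext z
  have h1 := (hf.differentiable (by simp)) z
  simp only [dbar, fderiv_const_smul h1 c, Pi.smul_apply, smul_apply, smul_eq_mul]
  ring

lemma iter_dbar {n : ℕ} (r : Fin n) (j : ℕ) :
    (∀ f : (Fin n → ℂ) → ℂ, ContDiff ℝ ∞ f → ContDiff ℝ ∞ ((dbar r)^[j] f)) ∧
    (∀ f g : (Fin n → ℂ) → ℂ, ContDiff ℝ ∞ f → ContDiff ℝ ∞ g →
      (dbar r)^[j] (f + g) = (dbar r)^[j] f + (dbar r)^[j] g) ∧
    (∀ (c : ℂ) (f : (Fin n → ℂ) → ℂ), ContDiff ℝ ∞ f →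
      (dbar r)^[j] (c • f) = c • (dbar r)^[j] f) := by
  induction j with
  | zero => simp
  | succ j ih =>
    obtain ⟨h1, h2, h3⟩ := ih
    simp only [Function.iterate_succ', Function.comp_apply]
    refine ⟨fun f hf => contDiff_dbar r (h1 f hf), fun f g hf hg => ?_, fun c f hf => ?_⟩
    · rw [h2 f g hf hg, dbar_add r (h1 f hf) (h1 g hg)]
    · rw [h3 c f hf, dbar_smul r c (h1 f hf)]

lemma foldr_dbar {n : ℕ} (k : Fin n → ℕ) (l : List (Fin n)) :
    (∀ f : (Fin n → ℂ) → ℂ, ContDiff ℝ ∞ f →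
      ContDiff ℝ ∞ (l.foldr (fun r g => (dbar r)^[k r] g) f)) ∧
    (∀ f g : (Fin n → ℂ) → ℂ, ContDiff ℝ ∞ f → ContDiff ℝ ∞ g →
      l.foldr (fun r g => (dbar r)^[k r] g) (f + g) =
        l.foldr (fun r g => (dbar r)^[k r] g) f + l.foldr (fun r g => (dbar r)^[k r] g) g) ∧
    (∀ (c : ℂ) (f : (Fin n → ℂ) → ℂ), ContDiff ℝ ∞ f →
      l.foldr (fun r g => (dbar r)^[k r] g) (c • f) =
        c • l.foldr (fun r g => (dbar r)^[k r] g) f) := by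
  induction l with
  | nil => simp
  | cons a l ih =>
    obtain ⟨h1, h2, h3⟩ := ih
    obtain ⟨i1, i2, i3⟩ := iter_dbar a (k a)
    simp only [List.foldr_cons]
    refine ⟨fun f hf => i1 _ (h1 f hf), fun f g hf hg => ?_, fun c f hf => ?_⟩
    · rw [h2 f g hf hg, i2 _ _ (h1 f hf) (h1 g hg)]
    · rw [h3 c f hf, i3 _ _ (h1 f hf)]

/-- The measure `(α/π)ⁿ exp(-α |z|²) dz` on `ℂⁿ`, with the Euclidean `|z|² = ∑ |z_r|²`. -/
def gaussMeasure (n : ℕ) (α : ℝ) : Measure (Fin n → ℂ) :=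
  volume.withDensity fun z =>
    ENNReal.ofReal ((α / Real.pi) ^ n * Real.exp (-α * ∑ r, ‖z r‖ ^ 2))

/-- The `m`-analytic Bargmann--Segal--Fock space of functions on `ℂⁿ`. -/
def fock (n m : ℕ) (α : ℝ) : Submodule ℂ ((Fin n → ℂ) → ℂ) where
  carrier := {f | IsPolyanalytic m f ∧ MemLp f 2 (gaussMeasure n α)}
  add_mem' := by
    rintro f g ⟨⟨hf, hf'⟩, hf2⟩ ⟨⟨hg, hg'⟩, hg2⟩
    refine ⟨⟨hf.add hg, fun k hk => ?_⟩, hf2.add hg2⟩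
    have h := (foldr_dbar k (List.finRange n)).2.1 f g hf hg
    have h1 := hf' k hk
    have h2 := hg' k hk
    unfold dbarPow at *
    rw [h, h1, h2, add_zero]
  zero_mem' := by
    refine ⟨⟨contDiff_const, fun k hk => ?_⟩, MemLp.zero⟩
    have h := (foldr_dbar k (List.finRange n)).2.2 0 0 contDiff_const
    simpa [dbarPow] using h
  smul_mem' := by
    rintro c f ⟨⟨hf, hf'⟩, hf2⟩
    refine ⟨⟨contDiff_const.smul hf, fun k hk => ?_⟩, hf2.const_smul c⟩
    have h := (foldr_dbar k (List.finRange n)).2.2 c f hf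
    have h1 := hf' k hk
    unfold dbarPow at *
    rw [h, h1, smul_zero]

/-- `ℝ²ⁿ`, written as pairs `(x, y)` of vectors of the Euclidean space `ℝⁿ`. -/
abbrev R2 (n : ℕ) : Type := EuclideanSpace ℝ (Fin n) × EuclideanSpace ℝ (Fin n)

/-- The point `(x + i y) / √α` of `ℂⁿ`. -/
def toCn (n : ℕ) (α : ℝ) (p : R2 n) : Fin n → ℂ := fun r =>
  ((p.1 r : ℂ) + Complex.I * (p.2 r : ℂ)) / (Real.sqrt α : ℂ)

/-- The flattening operator
`(U f)(x, y) = 2^{n/2} exp(-|x|²/2 - |y|²/2 - i⟨x, y⟩) f((x + i y)/√α)`. -/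
def flatten (n : ℕ) (α : ℝ) : ((Fin n → ℂ) → ℂ) →ₗ[ℂ] (R2 n → ℂ) where
  toFun f := fun p =>
    (((2 : ℝ) ^ ((n : ℝ) / 2) : ℝ) : ℂ) *
      Complex.exp (-(1 / 2) * (‖p.1‖ ^ 2 : ℝ) - (1 / 2) * (‖p.2‖ ^ 2 : ℝ)
        - Complex.I * (inner ℝ p.1 p.2 : ℝ)) *
      f (toCn n α p)
  map_add' f g := by
    funext p
    simp only [Pi.add_apply]
    ring
  map_smul' c f := by
    funext p
    simp only [Pi.smul_apply, smul_eq_mul, RingHom.id_apply]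
    ring

/-- The measure `(2π)^{-n} dx dy` on `ℝ²ⁿ`. -/
def flatMeasure (n : ℕ) : Measure (R2 n) :=
  ENNReal.ofReal (((2 * Real.pi) ^ n)⁻¹) • volume

/-- The underlying set of functions of the flattened space: the image of the Fock space under
the flattening operator. -/
def flatSubmodule (n m : ℕ) (α : ℝ) : Submodule ℂ (R2 n → ℂ) :=
  (fock n m α).map (flatten n α)

lemma continuous_of_mem {n m : ℕ} {α : ℝ} {g : R2 n → ℂ} (hg : g ∈ flatSubmodule n m α) :
    Continuous g := by
  obtain ⟨f, ⟨⟨hf, -⟩, -⟩, rfl⟩ := hg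
  have h1 : Continuous (toCn n α) := by
    unfold toCn
    fun_prop
  have h2 : Continuous fun p => f (toCn n α p) := hf.continuous.comp h1
  change Continuous fun p => _ * _ * f (toCn n α p)
  fun_prop

/-- `(x, y) ↦ x + i y` preserves Lebesgue measure. -/
lemma measurePreserving_toCn_one (n : ℕ) :
    MeasurePreserving (toCn n 1) (volume : Measure (R2 n)) volume := by
  have h1 : MeasurePreserving (Prod.map (WithLp.ofLp (p := 2) (V := Fin n → ℝ))
      (WithLp.ofLp (p := 2) (V := Fin n → ℝ))) (volume : Measure (R2 n)) volume :=
    (PiLp.volume_preserving_ofLp (Fin n)).prod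
      (PiLp.volume_preserving_ofLp (Fin n))
  have h2 := (volume_measurePreserving_arrowProdEquivProdArrow ℝ ℝ (Fin n)).symm
  have h3 : MeasurePreserving (fun (a : Fin n → ℝ × ℝ) r =>
      Complex.measurableEquivRealProd.symm (a r)) volume volume :=
    volume_preserving_pi fun _ => Complex.volume_preserving_equiv_real_prod.symm
  have h := h3.comp (h2.comp h1)
  convert h using 1
  funext p r
  apply Complex.ext <;>
    simp [toCn, MeasurableEquiv.arrowProdEquivProdArrow, Equiv.arrowProdEquivProdArrow,
      Complex.measurableEquivRealProd]

lemma memLp_of_mem {n m : ℕ} {α : ℝ} (hα : 0 < α) {g : R2 n → ℂ}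
    (hg : g ∈ flatSubmodule n m α) : MemLp g 2 (flatMeasure n) := by
  have hc := continuous_of_mem hg
  rw [memLp_two_iff_integrable_sq_norm hc.aestronglyMeasurable]
  obtain ⟨f, ⟨⟨hf, -⟩, hf2⟩, rfl⟩ := hg
  rw [memLp_two_iff_integrable_sq_norm hf.continuous.aestronglyMeasurable] at hf2
  refine Integrable.smul_measure ?_ ENNReal.ofReal_ne_top
  have hpi := Real.pi_pos
  unfold gaussMeasure at hf2
  rw [integrable_withDensity_iff (by fun_prop) (by simp)] at hf2
  have h1 := hf2.comp_smul (R := (Real.sqrt α)⁻¹) (by positivity)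
  have h2 := ((measurePreserving_toCn_one n).integrable_comp h1.aestronglyMeasurable).2 h1
  refine (h2.const_mul (2 ^ n * ((α / Real.pi) ^ n)⁻¹)).congr (ae_of_all _ fun p => ?_)
  have e : (Real.sqrt α)⁻¹ • toCn n 1 p = toCn n α p := by
    funext r
    simp [toCn]
    ring
  have e2 : α * ∑ r, ‖toCn n α p r‖ ^ 2 = ‖p.1‖ ^ 2 + ‖p.2‖ ^ 2 := by
    rw [EuclideanSpace.real_norm_sq_eq, EuclideanSpace.real_norm_sq_eq, ← Finset.sum_add_distrib,
      Finset.mul_sum]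
    refine Finset.sum_congr rfl fun r _ => ?_
    simp only [toCn, norm_div, div_pow, Complex.norm_real, Real.norm_eq_abs, sq_abs,
      Real.sq_sqrt hα.le, mul_comm Complex.I]
    rw [← Complex.normSq_eq_norm_sq, Complex.normSq_add_mul_I]
    field_simp
  have e3 : ((2 : ℝ) ^ ((n : ℝ) / 2)) ^ 2 = 2 ^ n := by
    rw [← Real.rpow_natCast, ← Real.rpow_mul (by norm_num)]
    norm_num
  simp only [Function.comp_apply, e, flatten, LinearMap.coe_mk, AddHom.coe_mk, norm_mul,
    Complex.norm_exp, mul_pow, Complex.norm_real, Real.norm_eq_abs, sq_abs, e3, neg_mul, e2]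
  rw [ENNReal.toReal_ofReal (by positivity), ← Real.exp_nat_mul]
  have e4 : ((2 : ℕ) : ℝ) * (-((1 / 2 : ℂ) * ((‖p.1‖ ^ 2 : ℝ) : ℂ)) -
      1 / 2 * ((‖p.2‖ ^ 2 : ℝ) : ℂ) - Complex.I * ((inner ℝ p.1 p.2 : ℝ) : ℂ)).re
      = -(‖p.1‖ ^ 2 + ‖p.2‖ ^ 2) := by
    simp only [Complex.sub_re, Complex.neg_re, Complex.mul_re, Complex.ofReal_re,
      Complex.ofReal_im, Complex.I_re, Complex.I_im]
    norm_num
    ring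
  rw [e4]
  have : (α / Real.pi) ^ n ≠ 0 := by positivity
  field_simp

/-- The flattened space: the functions in the image of the flattening operator. It is a type of
its own because it carries the `L²` norm below, not the topology of pointwise convergence. -/
def FlatSpace (n m : ℕ) (α : ℝ) (_hα : 0 < α) : Type := flatSubmodule n m α

namespace FlatSpace

variable {n m : ℕ} {α : ℝ} {hα : 0 < α}

instance : AddCommGroup (FlatSpace n m α hα) :=
  inferInstanceAs (AddCommGroup (flatSubmodule n m α))

instance : Module ℂ (FlatSpace n m α hα) :=
  inferInstanceAs (Module ℂ (flatSubmodule n m α))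

/-- An element of the flattened space as a function on `ℝ²ⁿ`. -/
def toFun (g : FlatSpace n m α hα) : R2 n → ℂ := g.1

/-- The inclusion of the flattened space into `L²(ℝ²ⁿ, (2π)^{-n} dx dy)`. -/
def toL2 : FlatSpace n m α hα →ₗ[ℂ] Lp ℂ 2 (flatMeasure n) where
  toFun g := (memLp_of_mem hα g.2).toLp g.1
  map_add' _ _ := rfl
  map_smul' _ _ := rfl

lemma toL2_injective :
    Function.Injective (toL2 : FlatSpace n m α hα →ₗ[ℂ] Lp ℂ 2 (flatMeasure n)) := by
  intro g h hgh
  have h1 : g.1 =ᵐ[flatMeasure n] h.1 := 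
    (MemLp.toLp_eq_toLp_iff (memLp_of_mem hα g.2) (memLp_of_mem hα h.2)).1 hgh
  have hpi := Real.pi_pos
  have h0 : ENNReal.ofReal (((2 * Real.pi) ^ n)⁻¹) ≠ 0 := by
    simp only [ne_eq, ENNReal.ofReal_eq_zero, not_le]
    positivity
  unfold flatMeasure at h1
  have h2 : g.1 =ᵐ[volume] h.1 := by
    rwa [Filter.EventuallyEq, Measure.ae_ennreal_smul_measure_eq h0] at h1
  exact Subtype.ext ((continuous_of_mem g.2).ae_eq_iff_eq volume (continuous_of_mem h.2) |>.1 h2)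

/-- The norm of `L²(ℝ²ⁿ, (2π)^{-n} dx dy)`. -/
instance : NormedAddCommGroup (FlatSpace n m α hα) :=
  NormedAddCommGroup.induced _ _ toL2 toL2_injective

/-- The inner product of `L²(ℝ²ⁿ, (2π)^{-n} dx dy)`. -/
instance : InnerProductSpace ℂ (FlatSpace n m α hα) where
  norm_smul_le c g := by
    change ‖toL2 (c • g)‖ ≤ ‖c‖ * ‖toL2 g‖
    rw [map_smul, norm_smul]
  inner g h := inner ℂ (toL2 g) (toL2 h)
  norm_sq_eq_re_inner g := norm_sq_eq_re_inner (𝕜 := ℂ) (toL2 g)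
  conj_inner_symm g h := inner_conj_symm (toL2 g) (toL2 h)
  add_left f g h := by
    rw [map_add, inner_add_left]
  smul_left g h c := by
    rw [map_smul, inner_smul_left]

end FlatSpace

/-- The generalized Laguerre polynomial
`L_p^{(a)}(t) = ∑_{i=0}^p (-1)^i binom(p + a, p - i) t^i / i!`, for `a = 0, 1, 2, …`. -/
def laguerre (a p : ℕ) (t : ℝ) : ℝ :=
  ∑ i ∈ Finset.range (p + 1),
    (-1) ^ i * ((p + a).choose (p - i) : ℝ) * t ^ i / (i.factorial : ℝ)

/-- The number of multi-indices `k ∈ ℕ₀ⁿ` with `|k| ≤ m - 1`. -/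
def dim (n m : ℕ) : ℕ := Nat.card {k : Fin n → ℕ // ∑ r, k r < m}

end PolyFock

end

/-! Everything rests on one identity at the origin: if `F` is `m`-analytic and the integrand is
integrable, then the integral of `F(w) L_{m-1}^{(n)}(|w|²) e^{-|w|²}` over `ℂⁿ` is `πⁿ F(0)`. The
weight is radial, so `F` may be replaced by its mean over the circles `θ ↦ e^{iθ} w`. Along a ray
this mean is a polynomial in `t²` of degree below `m` whose constant term comes from `F(0)`
(`PolyAnalytic.exists_circleMean_eq`). In polar coordinates only the moments of the weight against
`t^{2n-1+2l}`, `l < m`, remain. Those with `1 ≤ l` vanish by Laguerre orthogonality, and the one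
with `l = 0` is that of the plain Gaussian (`PolyAnalytic.integral_mul_laguerre`).

The reproducing property at a general point follows by recentring: translations and multiplication
by the holomorphic `exp(-⟨w, z⟩)` preserve `m`-analyticity, and they turn the conjugate kernel times
`U f` into the integrand above (`integral_star_flatKernel_mul`). The kernel itself lies in the
space, being `U` of a holomorphic exponential times a polynomial of degree `m - 1` in a squared
distance. Hence `‖K_p‖² = K_p(p) = 2ⁿ L_{m-1}^{(n)}(0)`, a binomial coefficient up to the factor
`2ⁿ`.

For completeness, this norm does not depend on `p`, so `L²` Cauchy sequences converge uniformly. The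
limit is again `m`-analytic by a mean value property: some fixed test function `ψ` satisfies `F ⋆ ψ
= F` for all `m`-analytic `F` (`exists_reproducing_bump`). The identity survives locally uniform
limits and lets all derivatives fall on `ψ`. -/

noncomputable section

/-! ### Calculus of `m`-analytic functions and the recursive form of the definition -/

namespace PolyFock

variable {n : ℕ}

/-- `m`-analyticity, by recursion on `m`: all the `∂f/∂z̄_r` are `(m - 1)`-analytic. -/
def PolyAnalytic : ℕ → ((Fin n → ℂ) → ℂ) → Prop
  | 0, f => f = 0
  | m + 1, f => ContDiff ℝ ∞ f ∧ ∀ r, PolyAnalytic m (dbar r f)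

lemma dbar_mul (r : Fin n) {f g : (Fin n → ℂ) → ℂ} (hf : ContDiff ℝ ∞ f)
    (hg : ContDiff ℝ ∞ g) : dbar r (f * g) = f * dbar r g + dbar r f * g := by
  funext z
  have h1 := (hf.differentiable (by simp)) z
  have h2 := (hg.differentiable (by simp)) z
  simp only [dbar, fderiv_mul h1 h2, Pi.add_apply, Pi.mul_apply, add_apply, smul_apply,
    smul_eq_mul]
  ring

lemma dbar_comp_affine (r : Fin n) (c : ℝ) (a : Fin n → ℂ) {f : (Fin n → ℂ) → ℂ}
    (hf : ContDiff ℝ ∞ f) :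
    dbar r (fun w => f (c • w + a)) = (c : ℂ) • fun w => dbar r f (c • w + a) := by
  funext w
  have h1 := ((hf.differentiable (by simp)) (c • w + a)).hasFDerivAt
  have h2 : HasFDerivAt (fun w : Fin n → ℂ => c • w + a)
      (c • ContinuousLinearMap.id ℝ (Fin n → ℂ)) w :=
    ((hasFDerivAt_id w).const_smul c).add_const a
  have h3 := (h1.comp w h2).fderiv
  simp only [Function.comp_def] at h3
  simp only [dbar, h3, Pi.smul_apply, smul_eq_mul, ContinuousLinearMap.comp_apply, smul_apply,
    ContinuousLinearMap.id_apply, map_smul, Complex.real_smul]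
  ring

/-- Symmetry of the second derivative. It is what allows a word in the `∂/∂z̄_r` to be sorted into a
multi-index. -/
lemma dbar_comm (r s : Fin n) {f : (Fin n → ℂ) → ℂ} (hf : ContDiff ℝ ∞ f) :
    dbar r (dbar s f) = dbar s (dbar r f) := by
  have hd : Differentiable ℝ (fderiv ℝ f) :=
    (hf.fderiv_right (m := ∞) (by simp)).differentiable (by simp)
  have key : ∀ (q : Fin n) (z v : Fin n → ℂ), fderiv ℝ (dbar q f) z v =
      (1 / 2 : ℂ) * (fderiv ℝ (fderiv ℝ f) z v (Pi.single q 1) +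
        Complex.I * fderiv ℝ (fderiv ℝ f) z v (Pi.single q Complex.I)) := by
    intro q z v
    have h := (hd z).hasFDerivAt
    have h1 : ∀ u : Fin n → ℂ, HasFDerivAt (fun z => fderiv ℝ f z u)
        ((fderiv ℝ (fderiv ℝ f) z).flip u) z := fun u => by
      simpa using h.clm_apply (hasFDerivAt_const u z)
    have h2 := (((h1 (Pi.single q 1)).add
      ((h1 (Pi.single q Complex.I)).const_mul Complex.I)).const_mul (1 / 2 : ℂ)).fderiv
    change fderiv ℝ (fun z => (1 / 2 : ℂ) * (fderiv ℝ f z (Pi.single q 1) +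
      Complex.I * fderiv ℝ f z (Pi.single q Complex.I))) z v = _
    erw [h2]
    simp [mul_add]
  have sym : ∀ z u v, fderiv ℝ (fderiv ℝ f) z u v = fderiv ℝ (fderiv ℝ f) z v u := fun z u v =>
    (hf.contDiffAt.isSymmSndFDerivAt
      (by simp only [minSmoothness_of_isRCLikeNormedField]; exact WithTop.coe_le_coe.2 le_top)) u v
  funext z
  rw [dbar, dbar, key, key, key, key, sym z (Pi.single r 1) (Pi.single s 1),
    sym z (Pi.single r 1) (Pi.single s Complex.I), sym z (Pi.single r Complex.I) (Pi.single s 1),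
    sym z (Pi.single r Complex.I) (Pi.single s Complex.I)]
  ring

lemma dbar_const (r : Fin n) (c : ℂ) : dbar r (fun _ : Fin n → ℂ => c) = 0 := by
  funext z
  simp [dbar]

lemma dbar_conj_coord (r s : Fin n) (a : ℂ) :
    dbar r (fun w : Fin n → ℂ => star (w s) - a) = fun _ => if r = s then 1 else 0 := by
  funext z
  have h : HasFDerivAt (fun w : Fin n → ℂ => star (w s) - a)
      (Complex.conjCLE.toContinuousLinearMap ∘L ContinuousLinearMap.proj (R := ℝ) s) z :=
    ((Complex.conjCLE.toContinuousLinearMap ∘L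
      ContinuousLinearMap.proj (R := ℝ) (φ := fun _ : Fin n => ℂ) s).hasFDerivAt).sub_const a
  rw [dbar, h.fderiv]
  rcases eq_or_ne r s with rfl | hrs
  · simp
    norm_num
  · simp [hrs, hrs.symm]

lemma dbar_eq_zero_of_differentiable (r : Fin n) {h : (Fin n → ℂ) → ℂ}
    (hh : Differentiable ℂ h) : dbar r h = 0 := by
  funext z
  have h1 : HasFDerivAt h ((fderiv ℂ h z).restrictScalars ℝ) z :=
    (hh z).hasFDerivAt.restrictScalars ℝ
  have h2 : (Pi.single r Complex.I : Fin n → ℂ) = Complex.I • Pi.single r 1 := by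
    rw [← Pi.single_smul]
    simp
  rw [dbar, h1.fderiv]
  simp only [ContinuousLinearMap.coe_restrictScalars', h2, map_smul, smul_eq_mul, ← mul_assoc,
    Complex.I_mul_I]
  simp

namespace PolyAnalytic

lemma contDiff {m : ℕ} {f : (Fin n → ℂ) → ℂ} (hf : PolyAnalytic m f) : ContDiff ℝ ∞ f := by
  cases m with
  | zero => rw [show f = 0 from hf]; exact contDiff_const
  | succ m => exact hf.1

lemma zero (m : ℕ) : PolyAnalytic m (0 : (Fin n → ℂ) → ℂ) := by
  induction m with
  | zero => rfl
  | succ m ih =>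
    refine ⟨contDiff_const, fun r => ?_⟩
    rw [show dbar r (0 : (Fin n → ℂ) → ℂ) = 0 from dbar_const r 0]
    exact ih

lemma mono_succ {m : ℕ} {f : (Fin n → ℂ) → ℂ} (hf : PolyAnalytic m f) :
    PolyAnalytic (m + 1) f := by
  induction m generalizing f with
  | zero => rw [show f = 0 from hf]; exact zero 1
  | succ m ih => exact ⟨hf.1, fun r => ih (hf.2 r)⟩

lemma mono {m m' : ℕ} (hm : m ≤ m') {f : (Fin n → ℂ) → ℂ} (hf : PolyAnalytic m f) :
    PolyAnalytic m' f := by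
  induction m', hm using Nat.le_induction with
  | base => exact hf
  | succ k _ ih => exact ih.mono_succ

lemma add {m : ℕ} {f g : (Fin n → ℂ) → ℂ} (hf : PolyAnalytic m f) (hg : PolyAnalytic m g) :
    PolyAnalytic m (f + g) := by
  induction m generalizing f g with
  | zero => rw [show f = 0 from hf, show g = 0 from hg, add_zero]; rfl
  | succ m ih =>
    refine ⟨hf.1.add hg.1, fun r => ?_⟩
    rw [dbar_add r hf.1 hg.1]
    exact ih (hf.2 r) (hg.2 r)

lemma const_smul {m : ℕ} {f : (Fin n → ℂ) → ℂ} (hf : PolyAnalytic m f) (c : ℂ) :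
    PolyAnalytic m (c • f) := by
  induction m generalizing f with
  | zero => rw [show f = 0 from hf, smul_zero]; rfl
  | succ m ih =>
    refine ⟨contDiff_const.smul hf.1, fun r => ?_⟩
    rw [dbar_smul r c hf.1]
    exact ih (hf.2 r)

lemma sum {ι : Type*} (s : Finset ι) {m : ℕ} {f : ι → (Fin n → ℂ) → ℂ}
    (hf : ∀ i ∈ s, PolyAnalytic m (f i)) : PolyAnalytic m (∑ i ∈ s, f i) :=
  Finset.sum_induction f (PolyAnalytic m) (fun _ _ => add) (zero m) hf

lemma holomorphic_mul {m : ℕ} {h f : (Fin n → ℂ) → ℂ} (hh : ContDiff ℝ ∞ h)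
    (hh' : Differentiable ℂ h) (hf : PolyAnalytic m f) : PolyAnalytic m (h * f) := by
  induction m generalizing f with
  | zero => rw [show f = 0 from hf, mul_zero]; rfl
  | succ m ih =>
    refine ⟨hh.mul hf.1, fun r => ?_⟩
    rw [dbar_mul r hh hf.1, dbar_eq_zero_of_differentiable r hh', zero_mul, add_zero]
    exact ih (hf.2 r)

/-- By the Leibniz rule `∂/∂z̄_r` either hits `f`, lowering its order, or turns the conjugate factor
into a constant; so one such factor costs one order. -/
lemma conj_coord_mul {m : ℕ} {f : (Fin n → ℂ) → ℂ} (hf : PolyAnalytic m f) (s : Fin n) (a : ℂ) :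
    PolyAnalytic (m + 1) ((fun w => star (w s) - a) * f) := by
  have hc : ContDiff ℝ ∞ (fun w : Fin n → ℂ => star (w s) - a) := by
    have : ContDiff ℝ ∞ (fun w : Fin n → ℂ => Complex.conjCLE (w s)) := by fun_prop
    exact this.sub contDiff_const
  induction m generalizing f with
  | zero => rw [show f = 0 from hf, mul_zero]; exact zero 1
  | succ m ih =>
    refine ⟨hc.mul hf.1, fun r => ?_⟩
    rw [dbar_mul r hc hf.1, dbar_conj_coord]
    refine add (ih (hf.2 r)) ?_
    split_ifs
    · convert! hf using 1
      funext w
      simp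
    · convert! zero (n := n) (m + 1) using 1
      funext w
      simp

lemma comp_affine {m : ℕ} {f : (Fin n → ℂ) → ℂ} (hf : PolyAnalytic m f) (c : ℝ)
    (a : Fin n → ℂ) : PolyAnalytic m (fun w => f (c • w + a)) := by
  induction m generalizing f with
  | zero => rw [show f = 0 from hf]; rfl
  | succ m ih =>
    refine ⟨hf.1.comp (by fun_prop), fun r => ?_⟩
    rw [dbar_comp_affine r c a hf.1]
    exact (ih (hf.2 r)).const_smul _

lemma const (c : ℂ) : PolyAnalytic 1 (fun _ : Fin n → ℂ => c) :=
  ⟨contDiff_const, fun r => dbar_const r c⟩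

/-- Each factor `|w - a|²` is a sum of products of one conjugate coordinate, costing one order, and
one holomorphic coordinate, costing none. -/
lemma sq_dist_pow (a : Fin n → ℂ) (i : ℕ) :
    PolyAnalytic (i + 1) (fun w : Fin n → ℂ => (((∑ r, ‖w r - a r‖ ^ 2) ^ i : ℝ) : ℂ)) := by
  induction i with
  | zero => simpa using const 1
  | succ i ih =>
    have h : (fun w : Fin n → ℂ => (((∑ r, ‖w r - a r‖ ^ 2) ^ (i + 1) : ℝ) : ℂ)) =
        ∑ r, (fun w : Fin n → ℂ => star (w r) - star (a r)) * ((fun w => w r - a r) *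
          fun w : Fin n → ℂ => (((∑ r, ‖w r - a r‖ ^ 2) ^ i : ℝ) : ℂ)) := by
      funext w
      simp only [Finset.sum_apply, Pi.mul_apply, pow_succ' _ i, ← mul_assoc, ← Finset.sum_mul]
      push_cast
      congr 1
      refine Finset.sum_congr rfl fun r _ => ?_
      rw [← star_sub, ← Complex.conj_mul']
      rfl
    rw [h]
    refine sum _ fun r _ => conj_coord_mul (holomorphic_mul ?_ ?_ ih) r _ <;> fun_prop

lemma iff_foldr {m : ℕ} {f : (Fin n → ℂ) → ℂ} : PolyAnalytic m f ↔
    ContDiff ℝ ∞ f ∧ ∀ l : List (Fin n), l.length = m → l.foldr dbar f = 0 := by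
  induction m generalizing f with
  | zero =>
    refine ⟨fun h => ⟨h.contDiff, fun l hl => ?_⟩, fun h => h.2 [] rfl⟩
    rw [List.length_eq_zero_iff.1 hl]
    exact h
  | succ m ih =>
    refine ⟨fun h => ⟨h.1, fun l hl => ?_⟩, fun h => ⟨h.1, fun r => ih.2
      ⟨contDiff_dbar r h.1, fun l hl => ?_⟩⟩⟩
    -- `foldr` applies the last letter of the word first, so the recursion peels words from the end.
    · rcases List.eq_nil_or_concat l with rfl | ⟨l', r, rfl⟩
      · simp at hl
      · simpa using (ih.1 (h.2 r)).2 l' (by simpa using hl)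
    · simpa using h.2 (l ++ [r]) (by simpa using hl)

end PolyAnalytic

/-- `∂/∂z̄_r` on the type of smooth functions. -/
def dbarSmooth (r : Fin n) (f : {f : (Fin n → ℂ) → ℂ // ContDiff ℝ ∞ f}) :
    {f : (Fin n → ℂ) → ℂ // ContDiff ℝ ∞ f} := ⟨dbar r f.1, contDiff_dbar r f.2⟩

lemma coe_foldr_dbarSmooth (l : List (Fin n)) (f : {f : (Fin n → ℂ) → ℂ // ContDiff ℝ ∞ f}) :
    (l.foldr dbarSmooth f).1 = l.foldr dbar f.1 := by
  induction l with
  | nil => rfl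
  | cons a l ih => simp [dbarSmooth, ih]

/-- The operators commute on smooth functions, so the argument passes through the subtype, where
`LeftCommutative` holds unconditionally. -/
lemma foldr_dbar_perm {l l' : List (Fin n)} (h : l.Perm l') {f : (Fin n → ℂ) → ℂ}
    (hf : ContDiff ℝ ∞ f) : l.foldr dbar f = l'.foldr dbar f := by
  have : LeftCommutative (dbarSmooth (n := n)) :=
    ⟨fun r s f => Subtype.ext (dbar_comm r s f.2)⟩
  rw [← coe_foldr_dbarSmooth l ⟨f, hf⟩, ← coe_foldr_dbarSmooth l' ⟨f, hf⟩, h.foldr_eq]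

lemma dbarPow_eq_foldr (k : Fin n → ℕ) (f : (Fin n → ℂ) → ℂ) :
    dbarPow k f = ((List.finRange n).flatMap fun r => List.replicate (k r) r).foldr dbar f := by
  have hrep : ∀ (j : ℕ) (r : Fin n) (g : (Fin n → ℂ) → ℂ),
      (List.replicate j r).foldr dbar g = (dbar r)^[j] g := by
    intro j r g
    induction j with
    | zero => rfl
    | succ j ih => rw [List.replicate_succ, List.foldr_cons, ih, Function.iterate_succ_apply']
  unfold dbarPow
  induction List.finRange n with
  | nil => rfl
  | cons a l ih => rw [List.foldr_cons, ih, List.flatMap_cons, List.foldr_append, hrep]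

/-- A word of length `m` is a permutation of the sorted word of its letter counts, a multi-index of
weight `m`. -/
theorem isPolyanalytic_iff {m : ℕ} {f : (Fin n → ℂ) → ℂ} :
    IsPolyanalytic m f ↔ PolyAnalytic m f := by
  rw [PolyAnalytic.iff_foldr]
  refine and_congr_right fun hf => ⟨fun h l hl => ?_, fun h k hk => ?_⟩
  · have hp : ((List.finRange n).flatMap fun r => List.replicate (l.count r) r).Perm l := by
      rw [List.perm_iff_count]
      intro a
      rw [List.count_flatMap]
      simp only [Function.comp_def, List.count_replicate, ← List.ofFn_eq_map, List.sum_ofFn]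
      simp
    rw [← foldr_dbar_perm hp hf, ← dbarPow_eq_foldr]
    refine h _ ?_
    rw [← hl, ← hp.length_eq]
    simp [List.length_flatMap, ← List.ofFn_eq_map, List.sum_ofFn]
  · rw [dbarPow_eq_foldr]
    refine h _ ?_
    simp [List.length_flatMap, ← List.ofFn_eq_map, List.sum_ofFn, hk]

end PolyFock

end

/-! ### Fourier coefficients of `m`-analytic functions on circles -/

noncomputable section

namespace PolyFock

variable {n : ℕ}

/-- The Fourier coefficient `∫₀^{2π} e^{-ikθ} F(t e^{iθ} z) dθ` of `F` on a circle through the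
complex line spanned by `z`. -/
def circleCoeff (F : (Fin n → ℂ) → ℂ) (z : Fin n → ℂ) (k : ℕ) (t : ℝ) : ℂ :=
  ∫ θ in (0 : ℝ)..2 * Real.pi, Complex.exp (-(k * θ * Complex.I)) *
    F (((t : ℂ) * Complex.exp (θ * Complex.I)) • z)

/-- The derivative `∑ z̄_r ∂F/∂z̄_r` in the antiholomorphic direction `z`. -/
def dbarDir (F : (Fin n → ℂ) → ℂ) (z : Fin n → ℂ) : (Fin n → ℂ) → ℂ :=
  ∑ r, star (z r) • dbar r F

/-- In `dF(v) + i dF(iv)` the complex linear part of `dF` cancels and the antilinear part doubles.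
-/
lemma fderiv_add_I_mul_fderiv (F : (Fin n → ℂ) → ℂ) (w z : Fin n → ℂ) (c : ℂ) :
    fderiv ℝ F w (c • z) + Complex.I * fderiv ℝ F w ((Complex.I * c) • z) =
      2 * star c * dbarDir F z w := by
  have key : ∀ v : Fin n → ℂ, fderiv ℝ F w v + Complex.I * fderiv ℝ F w (Complex.I • v) =
      2 * ∑ r, star (v r) * dbar r F w := by
    intro v
    have e1 : ∀ v : Fin n → ℂ, fderiv ℝ F w v =
        ∑ r, ((v r).re * fderiv ℝ F w (Pi.single r 1) +
          (v r).im * fderiv ℝ F w (Pi.single r Complex.I)) := by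
      intro v
      conv_lhs => rw [← Finset.univ_sum_single v, map_sum]
      refine Finset.sum_congr rfl fun r _ => ?_
      have : (Pi.single r (v r) : Fin n → ℂ) =
          (v r).re • (Pi.single r 1 : Fin n → ℂ) + (v r).im • (Pi.single r Complex.I : Fin n → ℂ) := by
        rw [← Pi.single_smul, ← Pi.single_smul, ← Pi.single_add]
        congr 1
        simp
      rw [this, map_add, map_smul, map_smul, Complex.real_smul, Complex.real_smul]
    rw [e1 v, e1 (Complex.I • v), Finset.mul_sum, Finset.mul_sum, ← Finset.sum_add_distrib]
    refine Finset.sum_congr rfl fun r _ => ?_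
    have hs : star (v r) = (v r).re - (v r).im * Complex.I := by
      apply Complex.ext <;> simp
    rw [hs, dbar]
    simp only [Pi.smul_apply, smul_eq_mul, Complex.mul_re, Complex.I_re, Complex.I_im,
      Complex.mul_im, zero_mul, one_mul, zero_sub, zero_add, Complex.ofReal_neg]
    linear_combination ((v r).im * fderiv ℝ F w (Pi.single r Complex.I) : ℂ) * Complex.I_sq
  rw [mul_smul, key]
  simp only [dbarDir, Finset.sum_apply, Pi.smul_apply, smul_eq_mul, star_mul, Finset.mul_sum]
  refine Finset.sum_congr rfl fun r _ => ?_
  ring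

lemma PolyAnalytic.dbarDir {m : ℕ} {F : (Fin n → ℂ) → ℂ} (hF : PolyAnalytic (m + 1) F)
    (z : Fin n → ℂ) : PolyAnalytic m (dbarDir F z) :=
  PolyAnalytic.sum _ fun r _ => (hF.2 r).const_smul _

lemma hasDerivAt_circleCoeff {F : (Fin n → ℂ) → ℂ} (hF : ContDiff ℝ ∞ F) (z : Fin n → ℂ) (k : ℕ)
    (t : ℝ) : HasDerivAt (circleCoeff F z k)
      (∫ θ in (0 : ℝ)..2 * Real.pi, Complex.exp (-(k * θ * Complex.I)) *
        fderiv ℝ F (((t : ℂ) * Complex.exp (θ * Complex.I)) • z)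
          (Complex.exp (θ * Complex.I) • z)) t := by
  have hcF : Continuous (fderiv ℝ F) := hF.continuous_fderiv (by simp)
  have hc := hF.continuous
  have hF' : Continuous fun p : ℝ × ℝ => Complex.exp (-(k * p.2 * Complex.I)) *
      fderiv ℝ F (((p.1 : ℂ) * Complex.exp (p.2 * Complex.I)) • z)
        (Complex.exp (p.2 * Complex.I) • z) := by
    refine Continuous.mul (by fun_prop) (Continuous.clm_apply (hcF.comp ?_) ?_) <;> fun_prop
  obtain ⟨C, hC⟩ := ((isCompact_closedBall t 1).prod
    (isCompact_Icc (a := (0 : ℝ)) (b := 2 * Real.pi))).exists_bound_of_continuousOn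
      hF'.continuousOn
  have hpi := Real.pi_pos
  refine (intervalIntegral.hasDerivAt_integral_of_dominated_loc_of_deriv_le (𝕜 := ℝ) (x₀ := t)
    (s := Metric.closedBall t 1) (F := fun t θ => Complex.exp (-(k * θ * Complex.I)) *
      F (((t : ℂ) * Complex.exp (θ * Complex.I)) • z)) (bound := fun _ => C)
    (F' := fun t θ => Complex.exp (-(k * θ * Complex.I)) *
        fderiv ℝ F (((t : ℂ) * Complex.exp (θ * Complex.I)) • z)
          (Complex.exp (θ * Complex.I) • z))
    (Metric.closedBall_mem_nhds t one_pos) ?_ ?_ ?_ ?_ ?_ ?_).2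
  · exact .of_forall fun x => Continuous.aestronglyMeasurable (by fun_prop)
  · exact Continuous.intervalIntegrable (by fun_prop) _ _
  · exact Continuous.aestronglyMeasurable (hF'.comp (by fun_prop : Continuous fun θ : ℝ => (t, θ)))
  · refine .of_forall fun θ hθ x hx => hC (x, θ) ⟨hx, ?_⟩
    rw [Set.uIoc_of_le (by positivity)] at hθ
    exact ⟨hθ.1.le, hθ.2⟩
  · exact intervalIntegrable_const
  · refine .of_forall fun θ _ x _ => ?_
    have h1 := ((hF.differentiable (by simp))
      (((x : ℂ) * Complex.exp (θ * Complex.I)) • z)).hasFDerivAt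
    have h2 : HasDerivAt (fun x : ℝ => ((x : ℂ) * Complex.exp (θ * Complex.I)) • z)
        (Complex.exp (θ * Complex.I) • z) x := by
      simpa using ((Complex.ofRealCLM.hasDerivAt (x := x)).mul_const
        (Complex.exp (θ * Complex.I))).smul_const z
    exact (h1.comp_hasDerivAt x h2).const_mul _

/-- Integration by parts in `θ`; the boundary terms cancel by `2π`-periodicity. -/
lemma integral_angular_deriv {F : (Fin n → ℂ) → ℂ} (hF : ContDiff ℝ ∞ F) (z : Fin n → ℂ) (k : ℕ)
    (t : ℝ) : ∫ θ in (0 : ℝ)..2 * Real.pi, Complex.exp (-(k * θ * Complex.I)) *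
        fderiv ℝ F (((t : ℂ) * Complex.exp (θ * Complex.I)) • z)
          ((Complex.I * (t * Complex.exp (θ * Complex.I))) • z) =
      k * Complex.I * circleCoeff F z k t := by
  have hcF : Continuous (fderiv ℝ F) := hF.continuous_fderiv (by simp)
  have hc := hF.continuous
  have hd : ∀ θ : ℝ, HasDerivAt (fun θ : ℝ => Complex.exp (-(k * θ * Complex.I)) *
      F (((t : ℂ) * Complex.exp (θ * Complex.I)) • z))
      (Complex.exp (-(k * θ * Complex.I)) *
        fderiv ℝ F (((t : ℂ) * Complex.exp (θ * Complex.I)) • z)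
          ((Complex.I * (t * Complex.exp (θ * Complex.I))) • z) -
      k * Complex.I * (Complex.exp (-(k * θ * Complex.I)) *
        F (((t : ℂ) * Complex.exp (θ * Complex.I)) • z))) θ := by
    intro θ
    have hθ : HasDerivAt (fun θ : ℝ => (θ : ℂ)) 1 θ := Complex.ofRealCLM.hasDerivAt
    have h1 := ((hF.differentiable (by simp))
      (((t : ℂ) * Complex.exp (θ * Complex.I)) • z)).hasFDerivAt
    have h2 : HasDerivAt (fun θ : ℝ => ((t : ℂ) * Complex.exp (θ * Complex.I)) • z)
        ((Complex.I * (t * Complex.exp (θ * Complex.I))) • z) θ := by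
      convert! (((hθ.mul_const Complex.I).cexp).const_mul (t : ℂ)).smul_const z using 2
      ring
    have h3 : HasDerivAt (fun θ : ℝ => Complex.exp (-(k * θ * Complex.I)))
        (-(k * Complex.I) * Complex.exp (-(k * θ * Complex.I))) θ := by
      convert! (((hθ.const_mul (k : ℂ)).mul_const Complex.I).fun_neg).cexp using 1
      ring
    convert! h3.mul (h1.comp_hasDerivAt θ h2) using 1
    simp only [Function.comp_apply]
    ring
  have hi1 : Continuous fun θ : ℝ => Complex.exp (-(k * θ * Complex.I)) *
        fderiv ℝ F (((t : ℂ) * Complex.exp (θ * Complex.I)) • z)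
          ((Complex.I * (t * Complex.exp (θ * Complex.I))) • z) := by
    refine Continuous.mul (by fun_prop) (Continuous.clm_apply (hcF.comp ?_) ?_) <;> fun_prop
  have hi2 : Continuous fun θ : ℝ => (k * Complex.I * (Complex.exp (-(k * θ * Complex.I)) *
        F (((t : ℂ) * Complex.exp (θ * Complex.I)) • z))) := by fun_prop
  have h := intervalIntegral.integral_eq_sub_of_hasDerivAt (fun θ _ => hd θ)
    ((hi1.sub hi2).intervalIntegrable 0 (2 * Real.pi))
  rw [intervalIntegral.integral_sub (hi1.intervalIntegrable _ _) (hi2.intervalIntegrable _ _),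
    intervalIntegral.integral_const_mul] at h
  have e1 : Complex.exp (-(k * ((2 * Real.pi : ℝ) : ℂ) * Complex.I)) = 1 := by
    rw [Complex.exp_eq_one_iff]
    exact ⟨-k, by push_cast; ring⟩
  have e2 : Complex.exp (((2 * Real.pi : ℝ) : ℂ) * Complex.I) = 1 := by
    push_cast
    exact Complex.exp_two_pi_mul_I
  rw [e1, e2] at h
  simp only [Complex.ofReal_zero, mul_zero, zero_mul, neg_zero, Complex.exp_zero, sub_self] at h
  exact sub_eq_zero.1 h

/-- The polar form of the Cauchy–Riemann operator: the radial derivative is twice the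
antiholomorphic one minus `i/t` times the angular one. The antilinear part contributes `e^{-iθ}`,
which moves the index from `k` to `k + 1`. -/
lemma hasDerivAt_circleCoeff' {F : (Fin n → ℂ) → ℂ} (hF : ContDiff ℝ ∞ F) (z : Fin n → ℂ) (k : ℕ)
    {t : ℝ} (ht : 0 < t) : HasDerivAt (circleCoeff F z k)
      (2 * circleCoeff (dbarDir F z) z (k + 1) t + k / t * circleCoeff F z k t) t := by
  have hcF : Continuous (fderiv ℝ F) := hF.continuous_fderiv (by simp)
  convert hasDerivAt_circleCoeff hF z k t using 1
  have ht' : (t : ℂ) ≠ 0 := by exact_mod_cast ht.ne'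
  have hcB : Continuous (dbarDir F z) := by
    have : dbarDir F z = fun w => ∑ r, star (z r) * dbar r F w := by
      funext w
      simp [dbarDir]
    rw [this]
    exact continuous_finsetSum _ fun r _ => continuous_const.mul (contDiff_dbar r hF).continuous
  have e : ∀ θ : ℝ, Complex.exp (-(k * θ * Complex.I)) *
        fderiv ℝ F (((t : ℂ) * Complex.exp (θ * Complex.I)) • z)
          (Complex.exp (θ * Complex.I) • z) =
      2 * (Complex.exp (-((k + 1 : ℕ) * θ * Complex.I)) *
        dbarDir F z (((t : ℂ) * Complex.exp (θ * Complex.I)) • z)) -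
      Complex.I / t * (Complex.exp (-(k * θ * Complex.I)) *
        fderiv ℝ F (((t : ℂ) * Complex.exp (θ * Complex.I)) • z)
          ((Complex.I * (t * Complex.exp (θ * Complex.I))) • z)) := by
    intro θ
    have h := fderiv_add_I_mul_fderiv F (((t : ℂ) * Complex.exp (θ * Complex.I)) • z) z
      (Complex.exp (θ * Complex.I))
    have h1 : (Complex.I * (t * Complex.exp (θ * Complex.I))) • z =
        t • ((Complex.I * Complex.exp (θ * Complex.I)) • z) := by
      rw [← Complex.coe_smul, smul_smul]
      congr 1
      ring
    have h2 : star (Complex.exp (θ * Complex.I)) = Complex.exp (-(θ * Complex.I)) := by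
      change (starRingEnd ℂ) _ = _
      rw [← Complex.exp_conj]
      simp
    have h3 : Complex.exp (-((k + 1 : ℕ) * θ * Complex.I)) =
        Complex.exp (-(k * θ * Complex.I)) * Complex.exp (-(θ * Complex.I)) := by
      rw [← Complex.exp_add]
      congr 1
      push_cast
      ring
    rw [h2] at h
    rw [h1, (fderiv ℝ F _).map_smul t, Complex.real_smul, h3]
    field_simp
    linear_combination h
  simp_rw [e]
  have hi1 : Continuous fun θ : ℝ => Complex.exp (-(k * θ * Complex.I)) *
        fderiv ℝ F (((t : ℂ) * Complex.exp (θ * Complex.I)) • z)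
          ((Complex.I * (t * Complex.exp (θ * Complex.I))) • z) := by
    refine Continuous.mul (by fun_prop) (Continuous.clm_apply (hcF.comp ?_) ?_) <;> fun_prop
  rw [intervalIntegral.integral_sub, intervalIntegral.integral_const_mul,
    intervalIntegral.integral_const_mul, integral_angular_deriv hF]
  · change 2 * circleCoeff (dbarDir F z) z (k + 1) t + k / t * circleCoeff F z k t =
      2 * circleCoeff (dbarDir F z) z (k + 1) t -
        Complex.I / t * (k * Complex.I * circleCoeff F z k t)
    linear_combination (k / t * circleCoeff F z k t) * Complex.I_sq
  · exact Continuous.intervalIntegrable (by fun_prop) _ _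
  · exact Continuous.intervalIntegrable (by fun_prop) _ _

/-- With `c_k` the coefficient, `t^{-k} c_k` has derivative `2 t^{-k}` times the coefficient of
index `k + 1` of the function `dbarDir F z`, whose order is one lower. By induction this is an odd
polynomial in `t`, and integrating it gives an even one. -/
theorem PolyAnalytic.exists_circleCoeff_eq {m : ℕ} {F : (Fin n → ℂ) → ℂ} (hF : PolyAnalytic m F)
    (z : Fin n → ℂ) (k : ℕ) : ∃ a : ℕ → ℂ, ∀ t : ℝ, 0 < t →
      circleCoeff F z k t = t ^ k * ∑ l ∈ Finset.range m, a l * (t : ℂ) ^ (2 * l) := by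
  induction m generalizing F k with
  | zero =>
    refine ⟨0, fun t _ => ?_⟩
    rw [show F = 0 from hF]
    simp [circleCoeff]
  | succ m ih =>
    obtain ⟨b, hb⟩ := ih (hF.dbarDir z) (k + 1)
    have hofReal : ∀ t : ℝ, HasDerivAt (fun t : ℝ => (t : ℂ)) 1 t := fun t =>
      Complex.ofRealCLM.hasDerivAt
    have hd : ∀ t ∈ Set.Ioi (0 : ℝ), HasDerivAt (fun t : ℝ => ((t : ℂ) ^ k)⁻¹ * circleCoeff F z k t -
        ∑ l ∈ Finset.range m, b l / (l + 1) * (t : ℂ) ^ (2 * l + 2)) 0 t := by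
      intro t ht
      have ht' : (t : ℂ) ≠ 0 := by exact_mod_cast (ne_of_gt ht)
      have h1 := hasDerivAt_circleCoeff' hF.1 z k ht
      have h2 := ((hofReal t).pow k).inv (pow_ne_zero k ht')
      have h3 : HasDerivAt (fun t : ℝ => ∑ l ∈ Finset.range m, b l / (l + 1) * (t : ℂ) ^ (2 * l + 2))
          (∑ l ∈ Finset.range m, 2 * b l * (t : ℂ) ^ (2 * l + 1)) t := by
        refine HasDerivAt.fun_sum fun l _ => ?_
        have hl : (l + 1 : ℂ) ≠ 0 := by exact_mod_cast l.succ_ne_zero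
        convert! ((hofReal t).pow (2 * l + 2)).const_mul (b l / (l + 1)) using 1
        push_cast
        field_simp
      convert! (h2.mul h1).sub h3 using 1
      rw [hb t ht]
      have hk : (k : ℂ) * (t : ℂ) ^ (k - 1) = k * t ^ k / t := by
        rcases k with _ | k
        · simp
        · rw [Nat.add_sub_cancel, pow_succ]
          field_simp
      have hs : ∑ l ∈ Finset.range m, 2 * b l * (t : ℂ) ^ (2 * l + 1) =
          2 * t * ∑ l ∈ Finset.range m, b l * (t : ℂ) ^ (2 * l) := by
        rw [Finset.mul_sum]
        refine Finset.sum_congr rfl fun l _ => ?_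
        ring
      rw [hs]
      simp only [mul_one, hk, Pi.inv_apply, Pi.pow_apply]
      field_simp
      ring
    have hconst : ∀ t ∈ Set.Ioi (0 : ℝ), ((t : ℂ) ^ k)⁻¹ * circleCoeff F z k t -
        ∑ l ∈ Finset.range m, b l / (l + 1) * (t : ℂ) ^ (2 * l + 2) =
        (((1 : ℝ) : ℂ) ^ k)⁻¹ * circleCoeff F z k 1 -
        ∑ l ∈ Finset.range m, b l / (l + 1) * ((1 : ℝ) : ℂ) ^ (2 * l + 2) := fun t ht =>
      isOpen_Ioi.is_const_of_deriv_eq_zero isPreconnected_Ioi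
        (fun x hx => (hd x hx).differentiableAt.differentiableWithinAt)
        (fun x hx => (hd x hx).deriv) ht (Set.mem_Ioi.2 one_pos)
    set c := (((1 : ℝ) : ℂ) ^ k)⁻¹ * circleCoeff F z k 1 -
        ∑ l ∈ Finset.range m, b l / (l + 1) * ((1 : ℝ) : ℂ) ^ (2 * l + 2)
    -- The constant of integration becomes the coefficient of index `0`; integration shifts the
    -- others up by one.
    refine ⟨fun l => if l = 0 then c else b (l - 1) / l, fun t ht => ?_⟩
    have ht' : (t : ℂ) ≠ 0 := by exact_mod_cast ht.ne'
    have h := hconst t ht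
    rw [sub_eq_iff_eq_add, inv_mul_eq_iff_eq_mul₀ (pow_ne_zero k ht')] at h
    rw [h, Finset.sum_range_succ']
    simp only [Nat.add_eq_zero_iff, one_ne_zero, and_false, if_false, if_true, mul_zero, pow_zero,
      mul_one, Nat.add_sub_cancel, Nat.cast_add, Nat.cast_one, mul_add]
    ring

/-- The mean of an `m`-analytic function over circles is an even polynomial in the radius. -/
theorem PolyAnalytic.exists_circleMean_eq {m : ℕ} {F : (Fin n → ℂ) → ℂ}
    (hF : PolyAnalytic (m + 1) F) (z : Fin n → ℂ) : ∃ a : ℕ → ℂ, a 0 = 2 * Real.pi * F 0 ∧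
      ∀ t : ℝ, 0 < t → circleCoeff F z 0 t =
        ∑ l ∈ Finset.range (m + 1), a l * (t : ℂ) ^ (2 * l) := by
  obtain ⟨a, ha⟩ := hF.exists_circleCoeff_eq z 0
  refine ⟨a, ?_, fun t ht => by simpa using ha t ht⟩
  -- The formula is known for `t > 0` only; letting `t → 0⁺` identifies `a 0`.
  have h1 : Filter.Tendsto (circleCoeff F z 0) (nhdsWithin 0 (Set.Ioi 0))
      (nhds (circleCoeff F z 0 0)) :=
    (hasDerivAt_circleCoeff hF.1 z 0 0).continuousAt.tendsto.mono_left nhdsWithin_le_nhds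
  have hc : Continuous fun t : ℝ => ∑ l ∈ Finset.range (m + 1), a l * (t : ℂ) ^ (2 * l) := by
    fun_prop
  have h2 : Filter.Tendsto (circleCoeff F z 0) (nhdsWithin 0 (Set.Ioi 0))
      (nhds (∑ l ∈ Finset.range (m + 1), a l * ((0 : ℝ) : ℂ) ^ (2 * l))) :=
    ((hc.tendsto 0).mono_left nhdsWithin_le_nhds).congr' (by
      filter_upwards [self_mem_nhdsWithin] with t ht
      simpa using (ha t ht).symm)
  have h3 := tendsto_nhds_unique h1 h2
  rw [Finset.sum_range_succ'] at h3
  simp only [circleCoeff] at h3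
  simpa using h3.symm

end PolyFock

end

/-! ### Polar coordinates and integration against radial weights -/

noncomputable section

namespace PolyFock

variable {n : ℕ}

/-- Lebesgue measure on `ℂⁿ`, carried by the type with the Euclidean norm. -/
def euclideanVolume (n : ℕ) : Measure (EuclideanSpace ℂ (Fin n)) :=
  Measure.map (PiLp.continuousLinearEquiv 2 ℝ (fun _ : Fin n => ℂ)).symm volume

instance : (euclideanVolume n).IsAddHaarMeasure :=
  (PiLp.continuousLinearEquiv 2 ℝ (fun _ : Fin n => ℂ)).symm.isAddHaarMeasure_map volume

lemma measurePreserving_toLp : MeasurePreserving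
    (PiLp.continuousLinearEquiv 2 ℝ (fun _ : Fin n => ℂ)).symm volume (euclideanVolume n) :=
  ⟨(PiLp.continuousLinearEquiv 2 ℝ (fun _ : Fin n => ℂ)).symm.continuous.measurable, rfl⟩

lemma finrank_euclidean : Module.finrank ℝ (EuclideanSpace ℂ (Fin n)) = 2 * n := by
  rw [(PiLp.continuousLinearEquiv 2 ℝ (fun _ : Fin n => ℂ)).toLinearEquiv.finrank_eq,
    Module.finrank_pi_fintype]
  simp [Complex.finrank_real_complex, mul_comm]

/-- Polar coordinates in `ℂⁿ`. -/
lemma measurePreserving_polar (n : ℕ) : MeasurePreserving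
    (homeomorphUnitSphereProd (EuclideanSpace ℂ (Fin n))) ((euclideanVolume n).comap (↑))
      ((euclideanVolume n).toSphere.prod (Measure.volumeIoiPow (2 * n - 1))) := by
  have h := (euclideanVolume n).measurePreserving_homeomorphUnitSphereProd
  rwa [finrank_euclidean] at h

lemma integrable_polar (hn : 1 ≤ n) {G : (Fin n → ℂ) → ℂ} (hG : Integrable G) :
    Integrable (fun p : Metric.sphere (0 : EuclideanSpace ℂ (Fin n)) 1 × Set.Ioi (0 : ℝ) =>
      G (((p.2 : ℝ) : ℂ) • (p.1 : EuclideanSpace ℂ (Fin n)).ofLp))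
      ((euclideanVolume n).toSphere.prod (Measure.volumeIoiPow (2 * n - 1))) ∧
    ∫ w, G w = ∫ p : Metric.sphere (0 : EuclideanSpace ℂ (Fin n)) 1 × Set.Ioi (0 : ℝ),
      G (((p.2 : ℝ) : ℂ) • (p.1 : EuclideanSpace ℂ (Fin n)).ofLp)
      ∂((euclideanVolume n).toSphere.prod (Measure.volumeIoiPow (2 * n - 1))) := by
  have : Nonempty (Fin n) := ⟨⟨0, hn⟩⟩
  let e := (PiLp.continuousLinearEquiv 2 ℝ (fun _ : Fin n => ℂ)).symm
  have hemb : MeasurableEmbedding e := e.toHomeomorph.measurableEmbedding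
  let G' : EuclideanSpace ℂ (Fin n) → ℂ := fun x => G x.ofLp
  have hGG' : G' ∘ e = G := rfl
  have hpol := measurePreserving_polar n
  have hpemb := (homeomorphUnitSphereProd (EuclideanSpace ℂ (Fin n))).measurableEmbedding
  let P : Metric.sphere (0 : EuclideanSpace ℂ (Fin n)) 1 × Set.Ioi (0 : ℝ) → ℂ :=
    fun p => G (((p.2 : ℝ) : ℂ) • (p.1 : EuclideanSpace ℂ (Fin n)).ofLp)
  have hP : P ∘ homeomorphUnitSphereProd (EuclideanSpace ℂ (Fin n)) = fun x => G' x.1 := by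
    funext x
    have hx : ‖x.1‖ ≠ 0 := norm_ne_zero_iff.2 x.2
    simp only [P, G', Function.comp_apply, homeomorphUnitSphereProd_apply_snd_coe,
      homeomorphUnitSphereProd_apply_fst_coe]
    congr 1
    funext r
    simp only [Pi.smul_apply, PiLp.smul_apply, smul_eq_mul, Complex.real_smul,
      Complex.ofReal_inv]
    rw [mul_inv_cancel_left₀ (by exact_mod_cast hx)]
  have hms : MeasurableSet ({0}ᶜ : Set (EuclideanSpace ℂ (Fin n))) :=
    (measurableSet_singleton _).compl
  have h1 : Integrable G' (euclideanVolume n) := by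
    rwa [← (measurePreserving_toLp (n := n)).integrable_comp_emb hemb]
  constructor
  · rw [← hpol.integrable_comp_emb hpemb]
    change Integrable (P ∘ _) _
    rw [hP]
    have h2 : IntegrableOn G' {0}ᶜ (euclideanVolume n) := h1.integrableOn
    rwa [integrableOn_iff_comap_subtypeVal hms] at h2
  · rw [← hpol.integral_comp hpemb]
    change _ = ∫ x, (P ∘ homeomorphUnitSphereProd (EuclideanSpace ℂ (Fin n))) x ∂_
    rw [hP, integral_subtype_comap hms G', restrict_compl_singleton,
      ← (measurePreserving_toLp (n := n)).integral_comp hemb G']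
    rfl

lemma integrable_radial (hn : 1 ≤ n) {χ : ℝ → ℝ}
    (h : IntegrableOn (fun t : ℝ => t ^ (2 * n - 1) * χ (t ^ 2)) (Set.Ioi 0)) :
    Integrable fun w : Fin n → ℂ => χ (∑ r, ‖w r‖ ^ 2) := by
  have : Nonempty (Fin n) := ⟨⟨0, hn⟩⟩
  have h1 := (integrable_fun_norm_addHaar (euclideanVolume n) (f := fun t => χ (t ^ 2))).2
    (by rw [finrank_euclidean]; exact h)
  have h2 := ((measurePreserving_toLp (n := n)).integrable_comp h1.aestronglyMeasurable).2 h1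
  refine h2.congr (.of_forall fun w => ?_)
  simp only [Function.comp_apply, EuclideanSpace.norm_sq_eq]
  rfl

lemma integral_volumeIoiPow (k : ℕ) (g : ℝ → ℂ) :
    ∫ t : Set.Ioi (0 : ℝ), g t ∂(Measure.volumeIoiPow k) =
      ∫ t in Set.Ioi (0 : ℝ), (t : ℂ) ^ k * g t := by
  simp only [Measure.volumeIoiPow, ENNReal.ofReal]
  rw [integral_withDensity_eq_integral_smul,
    integral_subtype_comap measurableSet_Ioi fun a ↦ Real.toNNReal (a ^ k) • g a,
    setIntegral_congr_fun measurableSet_Ioi fun x hx ↦ ?_]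
  · simp only [NNReal.smul_def, Real.coe_toNNReal _ (pow_nonneg (le_of_lt hx) _),
      Complex.real_smul, Complex.ofReal_pow]
  · exact (measurable_subtype_coe.pow_const _).real_toNNReal

lemma sum_norm_sq_smul (c : ℂ) (w : Fin n → ℂ) :
    ∑ r, ‖(c • w) r‖ ^ 2 = ‖c‖ ^ 2 * ∑ r, ‖w r‖ ^ 2 := by
  simp [mul_pow, Finset.mul_sum]

lemma measurePreserving_circle_smul {c : ℂ} (hc : ‖c‖ = 1) :
    MeasurePreserving (fun w : Fin n → ℂ => c • w) volume volume := by
  have h : MeasurePreserving (fun w : ℂ => c * w) volume volume := by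
    have := (rotation ⟨c, by simpa [Submonoid.unitSphere] using hc⟩).measurePreserving
    exact this
  exact volume_preserving_pi fun _ => h

/-- Rotations preserve both Lebesgue measure and the weight, so the `L¹` norm of each slice is
independent of `θ`. -/
lemma circle_smul_integrable {F : (Fin n → ℂ) → ℂ} (hF : Continuous F) {χ : ℝ → ℝ}
    (hχ : Continuous χ) (hint : Integrable fun w => F w * (χ (∑ r, ‖w r‖ ^ 2) : ℂ)) :
    Integrable (fun p : ℝ × (Fin n → ℂ) => F (Complex.exp (p.1 * Complex.I) • p.2) *
      (χ (∑ r, ‖p.2 r‖ ^ 2) : ℂ))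
      ((volume.restrict (Set.Ioc 0 (2 * Real.pi))).prod volume) := by
  have hrot : ∀ θ : ℝ, (fun w => F (Complex.exp (θ * Complex.I) • w) *
      (χ (∑ r, ‖w r‖ ^ 2) : ℂ)) = (fun w => F w * (χ (∑ r, ‖w r‖ ^ 2) : ℂ)) ∘
        fun w => Complex.exp (θ * Complex.I) • w := by
    intro θ
    funext w
    simp only [Function.comp_apply, sum_norm_sq_smul, Complex.norm_exp_ofReal_mul_I, one_pow,
      one_mul]
  have hmp : ∀ θ : ℝ, MeasurePreserving
      (fun w : Fin n → ℂ => Complex.exp (θ * Complex.I) • w) volume volume := fun θ =>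
    measurePreserving_circle_smul (Complex.norm_exp_ofReal_mul_I θ)
  have hcont : Continuous fun p : ℝ × (Fin n → ℂ) => F (Complex.exp (p.1 * Complex.I) • p.2) *
      (χ (∑ r, ‖p.2 r‖ ^ 2) : ℂ) := by fun_prop
  rw [integrable_prod_iff hcont.aestronglyMeasurable]
  refine ⟨.of_forall fun θ => ?_, ?_⟩
  · change Integrable (fun w => F (Complex.exp (θ * Complex.I) • w) * (χ (∑ r, ‖w r‖ ^ 2) : ℂ))
    rw [hrot]
    exact ((hmp θ).integrable_comp hint.aestronglyMeasurable).2 hint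
  · have hconst : ∀ θ : ℝ, ∫ w, ‖F (Complex.exp (θ * Complex.I) • w) *
        (χ (∑ r, ‖w r‖ ^ 2) : ℂ)‖ = ∫ w, ‖F w * (χ (∑ r, ‖w r‖ ^ 2) : ℂ)‖ := by
      intro θ
      have hemb : MeasurableEmbedding fun w : Fin n → ℂ => Complex.exp (θ * Complex.I) • w :=
        (Homeomorph.smulOfNeZero (Complex.exp (θ * Complex.I))
          (Complex.exp_ne_zero _)).measurableEmbedding
      rw [← (hmp θ).integral_comp hemb fun w => ‖F w * (χ (∑ r, ‖w r‖ ^ 2) : ℂ)‖]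
      refine integral_congr_ae (.of_forall fun w => ?_)
      exact congrArg norm (congrFun (hrot θ) w)
    simp only [hconst]
    exact integrable_const _

/-- Averaging over the circle action does not change integrals against radial weights. -/
lemma integral_circleMean {F : (Fin n → ℂ) → ℂ} (hF : Continuous F) {χ : ℝ → ℝ}
    (hχ : Continuous χ) (hint : Integrable fun w => F w * (χ (∑ r, ‖w r‖ ^ 2) : ℂ)) :
    Integrable (fun w => circleCoeff F w 0 1 * (χ (∑ r, ‖w r‖ ^ 2) : ℂ)) ∧
    ∫ w, circleCoeff F w 0 1 * (χ (∑ r, ‖w r‖ ^ 2) : ℂ) =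
      2 * Real.pi * ∫ w, F w * (χ (∑ r, ‖w r‖ ^ 2) : ℂ) := by
  have hi := circle_smul_integrable hF hχ hint
  have hpi := Real.pi_pos
  have e : ∀ w : Fin n → ℂ, circleCoeff F w 0 1 * (χ (∑ r, ‖w r‖ ^ 2) : ℂ) =
      ∫ θ in Set.Ioc 0 (2 * Real.pi), F (Complex.exp (θ * Complex.I) • w) *
        (χ (∑ r, ‖w r‖ ^ 2) : ℂ) := by
    intro w
    rw [integral_mul_const, ← intervalIntegral.integral_of_le (by positivity)]
    simp [circleCoeff]
  simp_rw [e]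
  refine ⟨hi.integral_prod_right, ?_⟩
  have hconst : ∀ θ : ℝ, ∫ w, F (Complex.exp (θ * Complex.I) • w) *
      (χ (∑ r, ‖w r‖ ^ 2) : ℂ) = ∫ w, F w * (χ (∑ r, ‖w r‖ ^ 2) : ℂ) := by
    intro θ
    have hemb : MeasurableEmbedding fun w : Fin n → ℂ => Complex.exp (θ * Complex.I) • w :=
      (Homeomorph.smulOfNeZero (Complex.exp (θ * Complex.I))
        (Complex.exp_ne_zero _)).measurableEmbedding
    rw [← (measurePreserving_circle_smul (Complex.norm_exp_ofReal_mul_I θ)).integral_comp hemb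
      fun w => F w * (χ (∑ r, ‖w r‖ ^ 2) : ℂ)]
    simp only [sum_norm_sq_smul, Complex.norm_exp_ofReal_mul_I, one_pow, one_mul]
  have hswap := integral_integral_swap (μ := volume.restrict (Set.Ioc 0 (2 * Real.pi)))
    (ν := (volume : Measure (Fin n → ℂ)))
    (f := fun θ w => F (Complex.exp (θ * Complex.I) • w) * (χ (∑ r, ‖w r‖ ^ 2) : ℂ)) hi
  rw [← hswap]
  simp only [hconst]
  simp [hpi.le]

lemma circleCoeff_real_smul (F : (Fin n → ℂ) → ℂ) (z : Fin n → ℂ) (t : ℝ) :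
    circleCoeff F ((t : ℂ) • z) 0 1 = circleCoeff F z 0 t := by
  simp only [circleCoeff, smul_smul]
  congr 1
  funext θ
  congr 3
  push_cast
  ring

/-- After circle averaging, each ray sees a polynomial in `t²`, of which only the constant term has
a possibly nonzero moment. The area of the sphere is left unevaluated. -/
lemma integral_mul_radial_aux (hn : 1 ≤ n) {m : ℕ} {F : (Fin n → ℂ) → ℂ}
    (hF : PolyAnalytic (m + 1) F) {χ : ℝ → ℝ} (hχ : Continuous χ)
    (hint : Integrable fun w => F w * (χ (∑ r, ‖w r‖ ^ 2) : ℂ))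
    (hmom : ∀ l ≤ m, IntegrableOn (fun t : ℝ => t ^ (2 * n - 1) * (t ^ (2 * l) * χ (t ^ 2)))
      (Set.Ioi 0))
    (hzero : ∀ l ≤ m, 1 ≤ l →
      ∫ t in Set.Ioi (0 : ℝ), t ^ (2 * n - 1) * (t ^ (2 * l) * χ (t ^ 2)) = 0) :
    ∫ w, F w * (χ (∑ r, ‖w r‖ ^ 2) : ℂ) = F 0 * ((euclideanVolume n).toSphere.real Set.univ *
      ((∫ t in Set.Ioi (0 : ℝ), t ^ (2 * n - 1) * χ (t ^ 2) : ℝ) : ℂ)) := by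
  have hpi : (2 * Real.pi : ℂ) ≠ 0 := by exact_mod_cast (mul_pos two_pos Real.pi_pos).ne'
  obtain ⟨h1, h2⟩ := integral_circleMean hF.contDiff.continuous hχ hint
  obtain ⟨h3, h4⟩ := integrable_polar hn h1
  rw [h2, integral_prod _ h3] at h4
  have hinner : ∀ σ : Metric.sphere (0 : EuclideanSpace ℂ (Fin n)) 1,
      ∫ t : Set.Ioi (0 : ℝ), circleCoeff F (((t : ℝ) : ℂ) • σ.1.ofLp) 0 1 *
        (χ (∑ r, ‖(((t : ℝ) : ℂ) • σ.1.ofLp) r‖ ^ 2) : ℂ) ∂(Measure.volumeIoiPow (2 * n - 1)) =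
      2 * Real.pi * F 0 * ((∫ t in Set.Ioi (0 : ℝ), t ^ (2 * n - 1) * χ (t ^ 2) : ℝ) : ℂ) := by
    intro σ
    obtain ⟨a, ha0, ha⟩ := hF.exists_circleMean_eq σ.1.ofLp
    have hσ : ∑ r, ‖σ.1.ofLp r‖ ^ 2 = 1 := by
      rw [← EuclideanSpace.norm_sq_eq, norm_eq_of_mem_sphere, one_pow]
    rw [integral_volumeIoiPow (2 * n - 1) fun t => circleCoeff F ((t : ℂ) • σ.1.ofLp) 0 1 *
        (χ (∑ r, ‖((t : ℂ) • σ.1.ofLp) r‖ ^ 2) : ℂ)]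
    have e : ∀ t ∈ Set.Ioi (0 : ℝ), (t : ℂ) ^ (2 * n - 1) *
        (circleCoeff F ((t : ℂ) • σ.1.ofLp) 0 1 *
        (χ (∑ r, ‖((t : ℂ) • σ.1.ofLp) r‖ ^ 2) : ℂ)) = ∑ l ∈ Finset.range (m + 1),
          a l * ((t ^ (2 * n - 1) * (t ^ (2 * l) * χ (t ^ 2)) : ℝ) : ℂ) := by
      intro t ht
      rw [circleCoeff_real_smul, ha t ht, sum_norm_sq_smul, hσ, Complex.norm_real,
        Real.norm_eq_abs, sq_abs, mul_one, Finset.sum_mul, Finset.mul_sum]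
      refine Finset.sum_congr rfl fun l _ => ?_
      push_cast
      ring
    have hI : ∀ l ∈ Finset.range (m + 1), Integrable (fun t : ℝ =>
        a l * ((t ^ (2 * n - 1) * (t ^ (2 * l) * χ (t ^ 2)) : ℝ) : ℂ))
        (volume.restrict (Set.Ioi 0)) := fun l hl =>
      ((hmom l (Nat.lt_succ_iff.1 (Finset.mem_range.1 hl))).ofReal (𝕜 := ℂ)).const_mul (a l)
    rw [setIntegral_congr_fun measurableSet_Ioi e, integral_finsetSum _ hI,
      Finset.sum_range_succ']
    simp only [integral_const_mul, integral_complex_ofReal]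
    rw [Finset.sum_eq_zero fun l hl => ?_, zero_add, ha0]
    · simp
    · rw [hzero (l + 1) (Finset.mem_range.1 hl) (Nat.le_add_left 1 l)]
      simp
  simp only [hinner, integral_const, Complex.real_smul] at h4
  refine mul_left_cancel₀ hpi ?_
  rw [h4]
  ring

/-- An `m`-analytic function is reproduced at the origin by every radial weight whose moments of
orders `2, 4, …, 2 (m - 1)` vanish. -/
theorem PolyAnalytic.integral_mul_radial (hn : 1 ≤ n) {m : ℕ} {F : (Fin n → ℂ) → ℂ}
    (hF : PolyAnalytic (m + 1) F) {χ : ℝ → ℝ} (hχ : Continuous χ)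
    (hint : Integrable fun w => F w * (χ (∑ r, ‖w r‖ ^ 2) : ℂ))
    (hmom : ∀ l ≤ m, IntegrableOn (fun t : ℝ => t ^ (2 * n - 1) * (t ^ (2 * l) * χ (t ^ 2)))
      (Set.Ioi 0))
    (hzero : ∀ l ≤ m, 1 ≤ l →
      ∫ t in Set.Ioi (0 : ℝ), t ^ (2 * n - 1) * (t ^ (2 * l) * χ (t ^ 2)) = 0) :
    ∫ w, F w * (χ (∑ r, ‖w r‖ ^ 2) : ℂ) =
      F 0 * ((∫ w : Fin n → ℂ, χ (∑ r, ‖w r‖ ^ 2) : ℝ) : ℂ) := by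
  have hint' : Integrable fun w : Fin n → ℂ => χ (∑ r, ‖w r‖ ^ 2) :=
    integrable_radial hn (by simpa using hmom 0 m.zero_le)
  -- The case `F = 1` identifies the constant as the total mass of the weight.
  have h1 := integral_mul_radial_aux hn (PolyAnalytic.const (n := n) 1) hχ
    (by simpa only [one_mul] using! hint'.ofReal (𝕜 := ℂ)) (fun l hl => hmom l (hl.trans m.zero_le))
    (fun l hl hl' => hzero l (hl.trans m.zero_le) hl')
  simp only [one_mul, integral_complex_ofReal] at h1
  rw [h1, integral_mul_radial_aux hn hF hχ hint hmom hzero]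

end PolyFock

end

/-! ### Moments of the Laguerre weight -/

noncomputable section

namespace PolyFock

variable {n : ℕ}

lemma integrableOn_pow_mul_exp_neg_sq (k : ℕ) :
    IntegrableOn (fun t : ℝ => t ^ k * Real.exp (-t ^ 2)) (Set.Ioi 0) := by
  have h := integrableOn_rpow_mul_exp_neg_rpow (p := 2) (s := k)
    (by linarith [(Nat.cast_nonneg k : (0 : ℝ) ≤ k)]) (by norm_num)
  exact_mod_cast h

lemma integral_odd_pow_mul_exp_neg_sq (k : ℕ) :
    ∫ t in Set.Ioi (0 : ℝ), t ^ (2 * k + 1) * Real.exp (-t ^ 2) = k.factorial / 2 := by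
  have h := integral_rpow_mul_exp_neg_rpow (p := 2) (q := ((2 * k + 1 : ℕ) : ℝ)) (by norm_num)
    (by linarith [(Nat.cast_nonneg (2 * k + 1) : (0 : ℝ) ≤ (2 * k + 1 : ℕ))])
  have e : (((2 * k + 1 : ℕ) : ℝ) + 1) / 2 = k + 1 := by push_cast; ring
  rw [e, Real.Gamma_nat_eq_factorial] at h
  simp only [Real.rpow_natCast, Real.rpow_ofNat] at h
  rw [h]
  ring

lemma choose_mul_factorial_div {p i : ℕ} (hi : i ≤ p) (l : ℕ) :
    ((p + n).choose (p - i) : ℝ) * ((n + l + i).factorial : ℝ) / (i.factorial : ℝ) =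
      (p + n).factorial / p.factorial *
        ((p.choose i : ℝ) * ((n + l + i).factorial / (n + i).factorial : ℝ)) := by
  rw [Nat.cast_choose ℝ (by omega : p - i ≤ p + n), Nat.cast_choose ℝ hi,
    show p + n - (p - i) = n + i by omega]
  have := Nat.factorial_ne_zero
  field_simp

/-- Up to sign this is the `p`-th finite difference, at `n + 1`, of the rising factorial of degree
`l < p`. -/
lemma sum_neg_one_pow_choose_mul_ascFactorial {p l : ℕ} (hl : l < p) (n : ℕ) :
    ∑ i ∈ Finset.range (p + 1), (-1 : ℝ) ^ i *
      ((p.choose i : ℝ) * ((n + l + i).factorial / (n + i).factorial : ℝ)) = 0 := by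
  have h := congrFun (Polynomial.fwdDiff_iter_eq_zero_of_degree_lt
    (P := ascPochhammer ℝ l) (n := p) (by rwa [ascPochhammer_natDegree])) ((n : ℝ) + 1)
  rw [fwdDiff_iter_eq_sum_shift] at h
  have e : ∀ i ∈ Finset.range (p + 1), (-1 : ℝ) ^ i *
      ((p.choose i : ℝ) * ((n + l + i).factorial / (n + i).factorial : ℝ)) =
      (-1) ^ p * (((-1 : ℤ) ^ (p - i) * (p.choose i : ℤ)) •
        (ascPochhammer ℝ l).eval ((n : ℝ) + 1 + i • (1 : ℝ))) := by
    intro i hi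
    have hi' : i ≤ p := Nat.lt_succ_iff.1 (Finset.mem_range.1 hi)
    have e1 : (ascPochhammer ℝ l).eval ((n : ℝ) + 1 + i • (1 : ℝ)) =
        ((n + l + i).factorial / (n + i).factorial : ℝ) := by
      have h2 : (n : ℝ) + 1 + i • (1 : ℝ) = ((n + i + 1 : ℕ) : ℝ) := by
        push_cast
        simp
        ring
      rw [h2, ← ascPochhammer_eval_cast, ascPochhammer_nat_eq_ascFactorial, eq_div_iff
        (by exact_mod_cast Nat.factorial_ne_zero _), show n + l + i = n + i + l by ring,
        ← Nat.factorial_mul_ascFactorial (n + i) l]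
      push_cast
      ring
    have e2 : (-1 : ℝ) ^ i = (-1) ^ p * (-1) ^ (p - i) := by
      rw [← pow_add, show p + (p - i) = i + 2 * (p - i) by omega, pow_add, pow_mul]
      simp
    rw [e1, e2, zsmul_eq_mul]
    push_cast
    ring
  rw [Finset.sum_congr rfl e, ← Finset.mul_sum, h]
  simp

/-- Up to sign this is the `p`-th finite difference of `1/x` at `q + 1`, computed by induction on
`p`. -/
lemma sum_neg_one_pow_choose_div (p q : ℕ) :
    ∑ i ∈ Finset.range (p + 1), (-1 : ℝ) ^ i * ((p.choose i : ℝ) / (q + 1 + i)) =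
      p.factorial * q.factorial / (q + 1 + p).factorial := by
  have h : ∀ q : ℕ, (fwdDiff (1 : ℝ))^[p] (fun x : ℝ => x⁻¹) ((q : ℝ) + 1) =
      (-1) ^ p * (p.factorial * q.factorial / (q + 1 + p).factorial) := by
    induction p with
    | zero =>
      intro q
      have := Nat.factorial_ne_zero q
      simp [Nat.factorial_succ]
      field_simp
    | succ p ih =>
      intro q
      have h1 := ih (q + 1)
      push_cast at h1
      rw [Function.iterate_succ_apply', fwdDiff, ih q, h1,
        show q + 1 + 1 + p = q + 1 + p + 1 by ring, ← add_assoc]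
      simp only [Nat.factorial_succ]
      have := Nat.factorial_ne_zero (q + 1 + p)
      have h3 : ((q : ℝ) + 1 + p + 1) ≠ 0 := by positivity
      push_cast
      field_simp
      ring
  have h1 := h q
  rw [fwdDiff_iter_eq_sum_shift] at h1
  have e : ∀ i ∈ Finset.range (p + 1), (-1 : ℝ) ^ i * ((p.choose i : ℝ) / (q + 1 + i)) =
      (-1) ^ p * (((-1 : ℤ) ^ (p - i) * (p.choose i : ℤ)) • ((q : ℝ) + 1 + i • (1 : ℝ))⁻¹) := by
    intro i hi
    have hi' : i ≤ p := Nat.lt_succ_iff.1 (Finset.mem_range.1 hi)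
    have e2 : (-1 : ℝ) ^ i = (-1) ^ p * (-1) ^ (p - i) := by
      rw [← pow_add, show p + (p - i) = i + 2 * (p - i) by omega, pow_add, pow_mul]
      simp
    rw [e2, zsmul_eq_mul]
    push_cast
    simp only [nsmul_eq_mul, mul_one]
    ring
  rw [Finset.sum_congr rfl e, ← Finset.mul_sum, h1, ← mul_assoc, ← mul_pow]
  simp

lemma laguerre_eq_eval (a p : ℕ) : ∃ q : Polynomial ℝ, ∀ t, laguerre a p t = q.eval t := by
  refine ⟨∑ i ∈ Finset.range (p + 1), Polynomial.C
    ((-1) ^ i * ((p + a).choose (p - i) : ℝ) / (i.factorial : ℝ)) * Polynomial.X ^ i, fun t => ?_⟩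
  rw [laguerre, Polynomial.eval_finsetSum]
  refine Finset.sum_congr rfl fun i _ => ?_
  simp
  ring

lemma integrableOn_pow_mul_eval_mul_exp (k : ℕ) (q : Polynomial ℝ) :
    IntegrableOn (fun t : ℝ => t ^ k * (q.eval (t ^ 2) * Real.exp (-t ^ 2))) (Set.Ioi 0) := by
  have h : ∀ t : ℝ, t ^ k * (q.eval (t ^ 2) * Real.exp (-t ^ 2)) =
      ∑ i ∈ Finset.range (q.natDegree + 1),
        q.coeff i * (t ^ (k + 2 * i) * Real.exp (-t ^ 2)) := by
    intro t
    rw [Polynomial.eval_eq_sum_range, Finset.sum_mul, Finset.mul_sum]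
    refine Finset.sum_congr rfl fun i _ => ?_
    ring
  simp_rw [h]
  exact integrable_finsetSum _ fun i _ => (integrableOn_pow_mul_exp_neg_sq _).const_mul _

lemma continuous_laguerre (a p : ℕ) : Continuous (laguerre a p) := by
  unfold laguerre
  fun_prop

lemma integral_moment_laguerre (hn : 1 ≤ n) (p l : ℕ) :
    ∫ t in Set.Ioi (0 : ℝ), t ^ (2 * n - 1) * (t ^ (2 * l) *
      (laguerre n p (t ^ 2) * Real.exp (-t ^ 2))) =
    (1 / 2) * ∑ i ∈ Finset.range (p + 1), (-1 : ℝ) ^ i *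
      (((p + n).choose (p - i) : ℝ) * ((n - 1 + l + i).factorial : ℝ) / (i.factorial : ℝ)) := by
  have h : ∀ t : ℝ, t ^ (2 * n - 1) * (t ^ (2 * l) *
      (laguerre n p (t ^ 2) * Real.exp (-t ^ 2))) = ∑ i ∈ Finset.range (p + 1),
      ((-1) ^ i * ((p + n).choose (p - i) : ℝ) / (i.factorial : ℝ)) *
        (t ^ (2 * (n - 1 + l + i) + 1) * Real.exp (-t ^ 2)) := by
    intro t
    rw [laguerre, Finset.sum_mul, Finset.mul_sum, Finset.mul_sum]
    refine Finset.sum_congr rfl fun i _ => ?_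
    rw [show 2 * (n - 1 + l + i) + 1 = (2 * n - 1) + 2 * l + 2 * i by omega, pow_add, pow_add,
      pow_mul t 2 i]
    ring
  simp_rw [h]
  rw [integral_finsetSum _ fun i _ => (integrableOn_pow_mul_exp_neg_sq _).const_mul _,
    Finset.mul_sum]
  refine Finset.sum_congr rfl fun i _ => ?_
  rw [integral_const_mul, integral_odd_pow_mul_exp_neg_sq]
  ring

/-- With `s = t²` this is orthogonality of `L_p^{(n)}` to `s^{l-1}` for the weight `sⁿ e^{-s}`. One
power of `s` is borrowed from `s^l`, since polar coordinates supply only `s^{n-1}`. -/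
lemma integral_moment_laguerre_eq_zero (hn : 1 ≤ n) {p l : ℕ} (hl : 1 ≤ l) (hlp : l ≤ p) :
    ∫ t in Set.Ioi (0 : ℝ), t ^ (2 * n - 1) * (t ^ (2 * l) *
      (laguerre n p (t ^ 2) * Real.exp (-t ^ 2))) = 0 := by
  rw [integral_moment_laguerre hn]
  have e : ∀ i ∈ Finset.range (p + 1), (-1 : ℝ) ^ i *
      (((p + n).choose (p - i) : ℝ) * ((n - 1 + l + i).factorial : ℝ) / (i.factorial : ℝ)) =
      (p + n).factorial / p.factorial * ((-1 : ℝ) ^ i *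
      ((p.choose i : ℝ) * ((n + (l - 1) + i).factorial / (n + i).factorial : ℝ))) := by
    intro i hi
    rw [show n - 1 + l + i = n + (l - 1) + i by omega,
      choose_mul_factorial_div (Nat.lt_succ_iff.1 (Finset.mem_range.1 hi))]
    ring
  rw [Finset.sum_congr rfl e, ← Finset.mul_sum,
    sum_neg_one_pow_choose_mul_ascFactorial (by omega) n]
  simp

lemma integral_laguerre_eq (hn : 1 ≤ n) (p : ℕ) :
    ∫ t in Set.Ioi (0 : ℝ), t ^ (2 * n - 1) * (laguerre n p (t ^ 2) * Real.exp (-t ^ 2)) =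
      ((n - 1).factorial : ℝ) / 2 := by
  have h := integral_moment_laguerre hn p 0
  simp only [mul_zero, pow_zero, one_mul, add_zero] at h
  rw [h]
  obtain ⟨q, rfl⟩ : ∃ q, n = q + 1 := ⟨n - 1, by omega⟩
  have e : ∀ i ∈ Finset.range (p + 1), (-1 : ℝ) ^ i *
      (((p + (q + 1)).choose (p - i) : ℝ) * ((q + 1 - 1 + i).factorial : ℝ) / (i.factorial : ℝ)) =
      (p + (q + 1)).factorial / p.factorial * ((-1 : ℝ) ^ i *
      ((p.choose i : ℝ) / (q + 1 + i))) := by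
    intro i hi
    have hi' := Nat.lt_succ_iff.1 (Finset.mem_range.1 hi)
    rw [Nat.cast_choose ℝ (by omega : p - i ≤ p + (q + 1)), Nat.cast_choose ℝ hi',
      show p + (q + 1) - (p - i) = q + i + 1 by omega, Nat.add_sub_cancel, Nat.factorial_succ (q + i)]
    have := Nat.factorial_ne_zero
    have h3 : ((q : ℝ) + 1 + i) ≠ 0 := by positivity
    have h4 : ((q : ℝ) + i + 1) ≠ 0 := by positivity
    push_cast
    field_simp
    ring
  rw [Finset.sum_congr rfl e, ← Finset.mul_sum, sum_neg_one_pow_choose_div,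
    show q + 1 + p = p + (q + 1) by ring, Nat.add_sub_cancel]
  have := Nat.factorial_ne_zero
  field_simp

lemma integral_exp_neg_sum_norm_sq (n : ℕ) :
    ∫ w : Fin n → ℂ, Real.exp (-∑ r, ‖w r‖ ^ 2) = Real.pi ^ n := by
  have h : ∀ w : Fin n → ℂ, Real.exp (-∑ r, ‖w r‖ ^ 2) = ∏ r, Real.exp (-1 * ‖w r‖ ^ 2) := by
    intro w
    rw [← Real.exp_sum]
    simp
  simp_rw [h]
  rw [integral_fintype_prod_volume_eq_prod (fun _ : Fin n => fun z : ℂ => Real.exp (-1 * ‖z‖ ^ 2))]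
  rw [Finset.prod_const, GaussianFourier.integral_rexp_neg_mul_sq_norm one_pos]
  simp [Complex.finrank_real_complex]

/-- The radial integral does not depend on `p`, so the total mass equals that of `p = 0`, the
Gaussian; the area of the sphere is never needed. -/
lemma integral_laguerre_mul_exp (hn : 1 ≤ n) (p : ℕ) :
    ∫ w : Fin n → ℂ, laguerre n p (∑ r, ‖w r‖ ^ 2) * Real.exp (-∑ r, ‖w r‖ ^ 2) =
      Real.pi ^ n := by
  have key : ∀ p, ((∫ w : Fin n → ℂ, laguerre n p (∑ r, ‖w r‖ ^ 2) *
      Real.exp (-∑ r, ‖w r‖ ^ 2) : ℝ) : ℂ) = (euclideanVolume n).toSphere.real Set.univ *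
        (((n - 1).factorial / 2 : ℝ) : ℂ) := by
    intro p
    obtain ⟨q, hq⟩ := laguerre_eq_eval n p
    have hi : IntegrableOn (fun t : ℝ => t ^ (2 * n - 1) *
        (laguerre n p (t ^ 2) * Real.exp (-t ^ 2))) (Set.Ioi 0) := by
      simp_rw [hq]
      exact integrableOn_pow_mul_eval_mul_exp _ q
    have hint := integrable_radial hn (χ := fun s => laguerre n p s * Real.exp (-s)) hi
    have hL := continuous_laguerre n p
    have h1 := integral_mul_radial_aux hn (PolyAnalytic.const (n := n) 1)
      (χ := fun s => laguerre n p s * Real.exp (-s)) (by fun_prop)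
      (by simpa only [one_mul] using! hint.ofReal (𝕜 := ℂ))
      (fun l hl => by rw [Nat.le_zero.1 hl]; simpa using hi) (fun l hl hl' => by omega)
    simp only [one_mul, integral_complex_ofReal, integral_laguerre_eq hn] at h1
    exact h1
  have h0 : ∀ t, laguerre n 0 t = 1 := fun t => by simp [laguerre]
  have h := (key p).trans (key 0).symm
  simp only [h0, one_mul, integral_exp_neg_sum_norm_sq] at h
  exact_mod_cast h

/-- The Laguerre weight reproduces `m`-analytic functions at the origin. -/
theorem PolyAnalytic.integral_mul_laguerre (hn : 1 ≤ n) {p : ℕ} {F : (Fin n → ℂ) → ℂ}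
    (hF : PolyAnalytic (p + 1) F)
    (hint : Integrable fun w => F w *
      ((laguerre n p (∑ r, ‖w r‖ ^ 2) * Real.exp (-∑ r, ‖w r‖ ^ 2) : ℝ) : ℂ)) :
    ∫ w, F w * ((laguerre n p (∑ r, ‖w r‖ ^ 2) * Real.exp (-∑ r, ‖w r‖ ^ 2) : ℝ) : ℂ) =
      F 0 * Real.pi ^ n := by
  obtain ⟨q, hq⟩ := laguerre_eq_eval n p
  have hL := continuous_laguerre n p
  have h := hF.integral_mul_radial hn (χ := fun s => laguerre n p s * Real.exp (-s))
    (by fun_prop) hint (fun l _ => ?_) (fun l hl hl' => integral_moment_laguerre_eq_zero hn hl' hl)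
  · rw [h, integral_laguerre_mul_exp hn]
    push_cast
    rfl
  · have := integrableOn_pow_mul_eval_mul_exp (2 * n - 1 + 2 * l) q
    refine this.congr_fun (fun t _ => ?_) measurableSet_Ioi
    simp only [hq, pow_add]
    ring

end PolyFock

end

/-! ### A reproducing test function and closure under locally uniform limits -/

noncomputable section

namespace PolyFock

variable {n : ℕ}

lemma integrableOn_moment_of_eq_zero {χ : ℝ → ℝ} (hχ : Continuous χ)
    (hsupp : ∀ s, 4 ≤ s → χ s = 0) (k l : ℕ) :
    IntegrableOn (fun t : ℝ => t ^ k * (t ^ (2 * l) * χ (t ^ 2))) (Set.Ioi 0) := by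
  refine (Continuous.integrable_of_hasCompactSupport (by fun_prop) ?_).integrableOn
  refine HasCompactSupport.intro (isCompact_Icc (a := (-2 : ℝ)) (b := 2)) fun t ht => ?_
  rw [hsupp, mul_zero, mul_zero]
  by_contra! h
  exact ht (abs_le.1 (abs_le_of_sq_le_sq (by linarith : t ^ 2 ≤ 2 ^ 2) (by norm_num)))

/-- Dilating a weight by the factor `4` and subtracting kills one more moment. -/
lemma exists_weight_moments_eq_zero (hn : 1 ≤ n) (m : ℕ) :
    ∃ χ : ℝ → ℝ, ContDiff ℝ ∞ χ ∧ (∀ s, 4 ≤ s → χ s = 0) ∧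
      (∀ l ≤ m, 1 ≤ l →
        ∫ t in Set.Ioi (0 : ℝ), t ^ (2 * n - 1) * (t ^ (2 * l) * χ (t ^ 2)) = 0) ∧
      ∫ t in Set.Ioi (0 : ℝ), t ^ (2 * n - 1) * (t ^ (2 * 0) * χ (t ^ 2)) ≠ 0 := by
  induction m with
  | zero =>
    let ρ : ContDiffBump (0 : ℝ) := ⟨1, 2, one_pos, by norm_num⟩
    have hsupp : ∀ s : ℝ, 4 ≤ s → ρ s = 0 := fun s hs => ρ.zero_of_le_dist (by
      rw [Real.dist_eq, sub_zero, abs_of_nonneg (by linarith)]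
      change (2 : ℝ) ≤ s
      linarith)
    refine ⟨ρ, ρ.contDiff, hsupp, fun l hl hl' => by omega, ne_of_gt ?_⟩
    rw [setIntegral_pos_iff_support_of_nonneg_ae]
    · refine lt_of_lt_of_le (b := volume (Set.Ioo (0 : ℝ) 1)) (by simp)
        (measure_mono fun t ht => ⟨?_, ht.1⟩)
      have : ρ (t ^ 2) = 1 := ρ.one_of_mem_closedBall (by
        rw [Metric.mem_closedBall, Real.dist_eq, sub_zero, abs_of_nonneg (sq_nonneg t)]
        change t ^ 2 ≤ (1 : ℝ)
        nlinarith [ht.1, ht.2])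
      rw [Function.mem_support, this]
      have := ht.1
      positivity
    · filter_upwards [ae_restrict_mem measurableSet_Ioi] with t ht
      have h1 : 0 ≤ ρ (t ^ 2) := ρ.nonneg
      have h2 : (0 : ℝ) < t := ht
      change 0 ≤ t ^ (2 * n - 1) * (t ^ (2 * 0) * ρ (t ^ 2))
      positivity
    · exact integrableOn_moment_of_eq_zero ρ.continuous hsupp _ _
  | succ m ih =>
    obtain ⟨χ, hχ, hsupp, hzero, hne⟩ := ih
    have hscale : ∀ l, ∫ t in Set.Ioi (0 : ℝ), t ^ (2 * n - 1) * (t ^ (2 * l) * χ (4 * t ^ 2)) =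
        ((2 : ℝ) ^ (2 * n + 2 * l))⁻¹ *
          ∫ t in Set.Ioi (0 : ℝ), t ^ (2 * n - 1) * (t ^ (2 * l) * χ (t ^ 2)) := by
      intro l
      have h := integral_comp_mul_left_Ioi
        (fun t : ℝ => t ^ (2 * n - 1) * (t ^ (2 * l) * χ (t ^ 2))) 0 (b := 2) two_pos
      simp only [mul_zero, mul_pow, smul_eq_mul] at h
      have e : ∀ t : ℝ, t ^ (2 * n - 1) * (t ^ (2 * l) * χ (4 * t ^ 2)) =
          ((2 : ℝ) ^ (2 * n - 1 + 2 * l))⁻¹ *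
            (2 ^ (2 * n - 1) * t ^ (2 * n - 1) * (2 ^ (2 * l) * t ^ (2 * l) *
              χ (2 ^ 2 * t ^ 2))) := by
        intro t
        rw [pow_add]
        norm_num
        field_simp
      simp_rw [e]
      rw [integral_const_mul, h, ← mul_assoc, ← mul_inv]
      congr 2
      rw [← pow_succ]
      congr 1
      omega
    have hmom : ∀ l, ∫ t in Set.Ioi (0 : ℝ), t ^ (2 * n - 1) * (t ^ (2 * l) *
        (χ (t ^ 2) - 2 ^ (2 * n + 2 * (m + 1)) * χ (4 * t ^ 2))) =
        (1 - 2 ^ (2 * n + 2 * (m + 1)) * ((2 : ℝ) ^ (2 * n + 2 * l))⁻¹) *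
          ∫ t in Set.Ioi (0 : ℝ), t ^ (2 * n - 1) * (t ^ (2 * l) * χ (t ^ 2)) := by
      intro l
      have hi := integrableOn_moment_of_eq_zero (χ := fun s => χ (4 * s))
        (hχ.continuous.comp (by fun_prop)) (fun s hs => hsupp _ (by linarith)) (2 * n - 1) l
      rw [sub_mul, one_mul, mul_assoc, ← hscale, ← integral_const_mul, ← integral_sub
        (integrableOn_moment_of_eq_zero hχ.continuous hsupp _ _) (hi.const_mul _)]
      congr 1
      funext t
      ring
    -- Replacing `χ(s)` by `χ(4s)` multiplies the `l`-th moment by `2^{-(2n+2l)}`. The coefficient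
    -- cancels the moment `l = m + 1`, while the moment `l = 0` is multiplied by `1 - 2^{2(m+1)} ≠
    -- 0`.
    refine ⟨fun s => χ s - 2 ^ (2 * n + 2 * (m + 1)) * χ (4 * s), ?_, fun s hs => ?_,
      fun l hl hl' => ?_, ?_⟩
    · exact hχ.sub (contDiff_const.mul (hχ.comp (by fun_prop)))
    · simp only [hsupp s hs, hsupp (4 * s) (by linarith), mul_zero, sub_zero]
    · rw [hmom l]
      rcases Nat.lt_or_ge m l with h | h
      · rw [show l = m + 1 by omega, mul_inv_cancel₀ (by positivity), sub_self, zero_mul]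
      · rw [hzero l h hl', mul_zero]
    · rw [hmom 0]
      refine mul_ne_zero ?_ hne
      have h1 : (2 : ℝ) ^ (2 * n + 2 * (m + 1)) * ((2 : ℝ) ^ (2 * n + 2 * 0))⁻¹ =
          2 ^ (2 * (m + 1)) := by
        rw [pow_add, mul_zero, add_zero]
        field_simp
      have h2 : (1 : ℝ) < 2 ^ (2 * (m + 1)) := one_lt_pow₀ (by norm_num) (by omega)
      rw [h1]
      linarith

open scoped Convolution

lemma contDiff_sum_norm_sq : ContDiff ℝ ∞ fun w : Fin n → ℂ => ∑ r, ‖w r‖ ^ 2 := by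
  refine ContDiff.sum fun r _ => (contDiff_norm_sq ℝ).comp ?_
  fun_prop

/-- A compactly supported approximate identity that reproduces `m`-analytic functions exactly. -/
lemma exists_reproducing_bump (hn : 1 ≤ n) (m : ℕ) : ∃ ψ : (Fin n → ℂ) → ℂ,
    ContDiff ℝ ∞ ψ ∧ HasCompactSupport ψ ∧ ∀ F : (Fin n → ℂ) → ℂ, PolyAnalytic (m + 1) F →
      (F ⋆[ContinuousLinearMap.mul ℝ ℂ] ψ) = F := by
  obtain ⟨χ, hχ, hsupp, hzero, hne⟩ := exists_weight_moments_eq_zero hn m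
  have : Nonempty (Fin n) := ⟨⟨0, hn⟩⟩
  have hS : (euclideanVolume n).toSphere.real Set.univ ≠ 0 := by
    rw [measureReal_def, ENNReal.toReal_ne_zero]
    refine ⟨?_, measure_ne_top _ _⟩
    rw [ne_eq, Measure.measure_univ_eq_zero]
    exact Measure.toSphere_ne_zero _
  set c : ℂ := (euclideanVolume n).toSphere.real Set.univ *
      ((∫ t in Set.Ioi (0 : ℝ), t ^ (2 * n - 1) * χ (t ^ 2) : ℝ) : ℂ) with hc
  have hc0 : c ≠ 0 := by
    refine mul_ne_zero (by exact_mod_cast hS) ?_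
    simp only [mul_zero, pow_zero, one_mul] at hne
    exact_mod_cast hne
  let φ : (Fin n → ℂ) → ℂ := fun w => (χ (∑ r, ‖w r‖ ^ 2) : ℂ)
  have hφ : ContDiff ℝ ∞ φ :=
    Complex.ofRealCLM.contDiff.comp (hχ.comp contDiff_sum_norm_sq)
  have hφs : HasCompactSupport φ := by
    refine HasCompactSupport.intro (isCompact_closedBall (0 : Fin n → ℂ) 2) fun w hw => ?_
    simp only [φ]
    rw [hsupp, Complex.ofReal_zero]
    rw [mem_closedBall_zero_iff, pi_norm_le_iff_of_nonneg two_pos.le] at hw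
    push Not at hw
    obtain ⟨r, hr⟩ := hw
    have h1 : ‖w r‖ ^ 2 ≤ ∑ r, ‖w r‖ ^ 2 :=
      Finset.single_le_sum (f := fun r => ‖w r‖ ^ 2) (fun _ _ => by positivity) (Finset.mem_univ r)
    nlinarith
  refine ⟨fun w => c⁻¹ * φ w, contDiff_const.mul hφ, hφs.mul_left, fun F hF => ?_⟩
  funext z
  -- Reproduction at `z` is reproduction at `0` of the translate; the reflection in the convolution
  -- is harmless because the weight is even.
  have hF' : PolyAnalytic (m + 1) fun w => F ((1 : ℝ) • w + z) := hF.comp_affine 1 z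
  have hcont : Continuous fun w => F ((1 : ℝ) • w + z) * φ w :=
    hF'.contDiff.continuous.mul hφ.continuous
  have h := integral_mul_radial_aux hn hF' hχ.continuous
    (hcont.integrable_of_hasCompactSupport hφs.mul_left)
    (fun l _ => integrableOn_moment_of_eq_zero hχ.continuous hsupp _ _) hzero
  rw [← hc] at h
  simp only [one_smul, zero_add] at h
  rw [convolution_def]
  simp only [ContinuousLinearMap.mul_apply']
  rw [← integral_add_right_eq_self _ z]
  have e : ∀ w : Fin n → ℂ, F (w + z) * (c⁻¹ * φ (z - (w + z))) =
      c⁻¹ * (F (w + z) * (χ (∑ r, ‖w r‖ ^ 2) : ℂ)) := by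
    intro w
    have : φ (z - (w + z)) = (χ (∑ r, ‖w r‖ ^ 2) : ℂ) := by simp [φ]
    rw [this]
    ring
  simp_rw [e]
  rw [integral_const_mul, h]
  field_simp

lemma dbar_convolution (r : Fin n) {F ψ : (Fin n → ℂ) → ℂ} (hF : Continuous F)
    (hψ : ContDiff ℝ ∞ ψ) (hψs : HasCompactSupport ψ) :
    dbar r (F ⋆[ContinuousLinearMap.mul ℝ ℂ] ψ) =
      (F ⋆[ContinuousLinearMap.mul ℝ ℂ] dbar r ψ) := by
  funext z
  have hFi := hF.locallyIntegrable (μ := (volume : Measure (Fin n → ℂ)))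
  have h := (hψs.hasFDerivAt_convolution_right (ContinuousLinearMap.mul ℝ ℂ) hFi
    (hψ.of_le (by simp)) z).fderiv
  have hcf : Continuous (fderiv ℝ ψ) := hψ.continuous_fderiv (by simp)
  have key : ∀ v, fderiv ℝ (F ⋆[ContinuousLinearMap.mul ℝ ℂ] ψ) z v =
      ∫ t, F t * fderiv ℝ ψ (z - t) v := by
    intro v
    rw [h, convolution_precompR_apply _ hFi (hψs.fderiv ℝ) hcf, convolution_def]
    simp
  have hint : ∀ v, Integrable fun t => F t * fderiv ℝ ψ (z - t) v := by
    intro v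
    refine Continuous.integrable_of_hasCompactSupport ?_ ?_
    · exact hF.mul ((hcf.comp (by fun_prop)).clm_apply continuous_const)
    · have h1 : HasCompactSupport fun t => fderiv ℝ ψ (z - t) v :=
        ((hψs.fderiv ℝ).comp_homeomorph (Homeomorph.subLeft z)).comp_left
          (g := fun A : (Fin n → ℂ) →L[ℝ] ℂ => A v) (by simp)
      exact h1.mul_left
  rw [dbar, key, key, convolution_def]
  simp only [ContinuousLinearMap.mul_apply', dbar]
  rw [← integral_const_mul Complex.I, ← integral_add (hint _) ((hint _).const_mul _),
    ← integral_const_mul]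
  congr 1
  funext t
  ring

lemma tendstoUniformlyOn_convolution {f : ℕ → (Fin n → ℂ) → ℂ} {F ψ : (Fin n → ℂ) → ℂ}
    (hf : ∀ k, Continuous (f k)) (hF : Continuous F) (hψ : Continuous ψ)
    (hψs : HasCompactSupport ψ)
    (hlim : ∀ K, IsCompact K → TendstoUniformlyOn f F Filter.atTop K) (K : Set (Fin n → ℂ))
    (hK : IsCompact K) :
    TendstoUniformlyOn (fun k => (f k ⋆[ContinuousLinearMap.mul ℝ ℂ] ψ))
      (F ⋆[ContinuousLinearMap.mul ℝ ℂ] ψ) Filter.atTop K := by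
  have hψi : Integrable ψ := hψ.integrable_of_hasCompactSupport hψs
  have hexists : ∀ g : (Fin n → ℂ) → ℂ, Continuous g → ∀ z,
      Integrable fun t => g t * ψ (z - t) := by
    intro g hg z
    refine Continuous.integrable_of_hasCompactSupport (by fun_prop) ?_
    exact (hψs.comp_homeomorph (Homeomorph.subLeft z)).mul_left
  set A : ℝ := ∫ t, ‖ψ t‖
  have hA : 0 ≤ A := integral_nonneg fun _ => norm_nonneg _
  -- For `z ∈ K` the convolution sees only the values on the compact set `K - tsupport ψ`.
  have hK' : IsCompact ((fun p : (Fin n → ℂ) × (Fin n → ℂ) => p.1 - p.2) '' (K ×ˢ tsupport ψ)) :=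
    (hK.prod hψs).image (by fun_prop)
  rw [Metric.tendstoUniformlyOn_iff]
  intro ε hε
  have hδ : 0 < ε / (A + 1) := by positivity
  filter_upwards [Metric.tendstoUniformlyOn_iff.1 (hlim _ hK') _ hδ] with k hk z hz
  rw [dist_eq_norm, convolution_def, convolution_def]
  simp only [ContinuousLinearMap.mul_apply']
  rw [← integral_sub (hexists F hF z) (hexists (f k) (hf k) z)]
  have hbound : ∀ t, ‖F t * ψ (z - t) - f k t * ψ (z - t)‖ ≤ ε / (A + 1) * ‖ψ (z - t)‖ := by
    intro t
    rw [← sub_mul, norm_mul]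
    by_cases h0 : ψ (z - t) = 0
    · simp [h0]
    · have := hk t ⟨(z, z - t), ⟨hz, subset_tsupport _ h0⟩, by simp⟩
      rw [dist_eq_norm] at this
      gcongr
  calc ‖∫ t, (F t * ψ (z - t) - f k t * ψ (z - t))‖
      ≤ ∫ t, ε / (A + 1) * ‖ψ (z - t)‖ :=
        norm_integral_le_of_norm_le ((hψi.comp_sub_left z).norm.const_mul _) (.of_forall hbound)
    _ = ε / (A + 1) * A := by
        rw [integral_const_mul, integral_sub_left_eq_self (fun t => ‖ψ t‖)]
    _ < ε := by
        rw [div_mul_eq_mul_div, div_lt_iff₀ (by positivity)]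
        nlinarith

/-- Locally uniform limits of `m`-analytic functions are `m`-analytic. -/
theorem PolyAnalytic.of_tendstoUniformlyOn (hn : 1 ≤ n) {m : ℕ} {f : ℕ → (Fin n → ℂ) → ℂ}
    {F : (Fin n → ℂ) → ℂ} (hf : ∀ k, PolyAnalytic m (f k)) (hF : Continuous F)
    (hlim : ∀ K, IsCompact K → TendstoUniformlyOn f F Filter.atTop K) : PolyAnalytic m F := by
  induction m generalizing f F with
  | zero =>
    have h0 : ∀ k, f k = 0 := hf
    funext z
    have h1 := (hlim {z} isCompact_singleton).tendsto_at (Set.mem_singleton z)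
    simp only [h0, Pi.zero_apply] at h1
    exact tendsto_nhds_unique h1 tendsto_const_nhds
  | succ m ih =>
    obtain ⟨ψ, hψ, hψs, hrep⟩ := exists_reproducing_bump hn m
    have hfc : ∀ k, Continuous (f k) := fun k => (hf k).contDiff.continuous
    have hFψ : (F ⋆[ContinuousLinearMap.mul ℝ ℂ] ψ) = F := by
      funext z
      have h1 := (tendstoUniformlyOn_convolution hfc hF hψ.continuous hψs hlim {z}
        isCompact_singleton).tendsto_at (Set.mem_singleton z)
      simp only [fun k => hrep (f k) (hf k)] at h1
      exact tendsto_nhds_unique h1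
        ((hlim {z} isCompact_singleton).tendsto_at (Set.mem_singleton z))
    have hFs : ContDiff ℝ ∞ F := by
      rw [← hFψ]
      exact hψs.contDiff_convolution_right _ hF.locallyIntegrable hψ
    refine ⟨hFs, fun r => ih (f := fun k => dbar r (f k)) (fun k => (hf k).2 r)
      (contDiff_dbar r hFs).continuous fun K hK => ?_⟩
    have hdψ : HasCompactSupport (dbar r ψ) := by
      have h1 := (hψs.fderiv ℝ).comp_left
        (g := fun A : (Fin n → ℂ) →L[ℝ] ℂ => (1 / 2 : ℂ) * (A (Pi.single r 1) +
          Complex.I * A (Pi.single r Complex.I))) (by simp)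
      exact h1
    -- Since `∂f_k/∂z̄_r = f_k ⋆ ∂ψ/∂z̄_r`, the derivatives also converge locally uniformly, and the
    -- induction applies to them.
    have h1 := tendstoUniformlyOn_convolution hfc hF (contDiff_dbar r hψ).continuous hdψ hlim K hK
    rw [← dbar_convolution r hF hψ hψs, hFψ] at h1
    refine h1.congr (.of_forall fun k z _ => ?_)
    rw [← dbar_convolution r (hfc k) hψ hψs, hrep (f k) (hf k)]

end PolyFock

end

/-! ### The kernel and its reproducing property -/

noncomputable section

namespace PolyFock

variable {n : ℕ} {α : ℝ}

lemma toCn_eq_smul (p : R2 n) : toCn n α p = (Real.sqrt α)⁻¹ • toCn n 1 p := by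
  funext r
  simp [toCn]
  ring

lemma sum_norm_sq_toCn_sub (q p : R2 n) :
    ∑ r, ‖toCn n 1 q r - toCn n 1 p r‖ ^ 2 = ‖q.1 - p.1‖ ^ 2 + ‖q.2 - p.2‖ ^ 2 := by
  rw [EuclideanSpace.real_norm_sq_eq, EuclideanSpace.real_norm_sq_eq, ← Finset.sum_add_distrib]
  refine Finset.sum_congr rfl fun r _ => ?_
  have h : toCn n 1 q r - toCn n 1 p r =
      ((q.1 r - p.1 r : ℝ) : ℂ) + ((q.2 r - p.2 r : ℝ) : ℂ) * Complex.I := by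
    simp [toCn]
    ring
  rw [h, ← Complex.normSq_eq_norm_sq, Complex.normSq_add_mul_I]
  simp

lemma sum_norm_sq_toCn (q : R2 n) : ∑ r, ‖toCn n 1 q r‖ ^ 2 = ‖q.1‖ ^ 2 + ‖q.2‖ ^ 2 := by
  have h := sum_norm_sq_toCn_sub q 0
  have h0 : ∀ r, toCn n 1 (0 : R2 n) r = 0 := fun r => by simp [toCn]
  simpa [h0] using h

/-- The Hermitian pairing `∑ w_r z̄_r` on `ℂⁿ`. -/
def pairing (w z : Fin n → ℂ) : ℂ := ∑ r, w r * star (z r)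

lemma pairing_toCn (q p : R2 n) : pairing (toCn n 1 q) (toCn n 1 p) =
    ((inner ℝ q.1 p.1 : ℝ) : ℂ) + ((inner ℝ q.2 p.2 : ℝ) : ℂ) +
      Complex.I * (((inner ℝ q.2 p.1 : ℝ) : ℂ) - ((inner ℝ q.1 p.2 : ℝ) : ℂ)) := by
  simp only [pairing, PiLp.inner_apply, Complex.ofReal_sum, ← Finset.sum_add_distrib,
    ← Finset.sum_sub_distrib, Finset.mul_sum]
  refine Finset.sum_congr rfl fun r _ => ?_
  have h : star (toCn n 1 p r) = (p.1 r : ℂ) - Complex.I * (p.2 r : ℂ) := by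
    simp [toCn]
    ring
  rw [h]
  simp [toCn]
  linear_combination (-(q.2 r : ℂ) * p.2 r) * Complex.I_sq

lemma pairing_self_toCn (p : R2 n) : pairing (toCn n 1 p) (toCn n 1 p) =
    ((‖p.1‖ ^ 2 : ℝ) : ℂ) + ((‖p.2‖ ^ 2 : ℝ) : ℂ) := by
  rw [pairing_toCn, real_inner_self_eq_norm_sq, real_inner_self_eq_norm_sq,
    real_inner_comm p.1 p.2]
  ring

lemma contDiff_pairing (z : Fin n → ℂ) : ContDiff ℝ ∞ fun w : Fin n → ℂ => pairing w z := by
  unfold pairing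
  fun_prop

lemma differentiable_pairing (z : Fin n → ℂ) :
    Differentiable ℂ fun w : Fin n → ℂ => pairing w z := by
  unfold pairing
  fun_prop

/-- The exponent of the flattening operator. -/
def flatExponent (p : R2 n) : ℂ :=
  -(1 / 2) * (‖p.1‖ ^ 2 : ℝ) - (1 / 2) * (‖p.2‖ ^ 2 : ℝ) - Complex.I * (inner ℝ p.1 p.2 : ℝ)

lemma flatten_apply (f : (Fin n → ℂ) → ℂ) (p : R2 n) : flatten n α f p =
    (((2 : ℝ) ^ ((n : ℝ) / 2) : ℝ) : ℂ) * Complex.exp (flatExponent p) * f (toCn n α p) := rfl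

/-- The exponent of the reproducing kernel. -/
def kernelExponent (p q : R2 n) : ℂ :=
  -(1 / 2) * ((‖q.1 - p.1‖ ^ 2 + ‖q.2 - p.2‖ ^ 2 : ℝ) : ℂ) -
    Complex.I * (inner ℝ (q.1 - p.1) (q.2 + p.2) : ℝ)

/-- The reproducing kernel of the flattened space of `(d + 1)`-analytic functions. -/
def flatKernel (n d : ℕ) (p q : R2 n) : ℂ :=
  2 ^ n * Complex.exp (kernelExponent p q) *
    (laguerre n d (‖q.1 - p.1‖ ^ 2 + ‖q.2 - p.2‖ ^ 2) : ℂ)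

/-- This splitting exhibits the kernel as the image under `flatten` of a function whose exponential
part `exp ⟨w, z⟩` is holomorphic in `w`. -/
lemma kernelExponent_eq (p q : R2 n) : kernelExponent p q =
    flatExponent q + star (flatExponent p) + pairing (toCn n 1 q) (toCn n 1 p) := by
  have hs : star (flatExponent p) = -(1 / 2) * (‖p.1‖ ^ 2 : ℝ) - (1 / 2) * (‖p.2‖ ^ 2 : ℝ) +
      Complex.I * (inner ℝ p.1 p.2 : ℝ) := by
    simp [flatExponent]
  rw [hs, pairing_toCn, kernelExponent, flatExponent, norm_sub_sq_real, norm_sub_sq_real,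
    inner_sub_left, inner_add_right, inner_add_right, real_inner_comm q.2 p.1]
  push_cast
  ring

/-- Completing the square about `p`: the conjugate kernel times `U f` carries a constant, the
exponential of an antilinear-free pairing in `w - z`, and a Gaussian centred at `z`. -/
lemma star_kernelExponent_add (p q : R2 n) : star (kernelExponent p q) + flatExponent q =
    flatExponent p - pairing (toCn n 1 q - toCn n 1 p) (toCn n 1 p) -
      ((∑ r, ‖(toCn n 1 q - toCn n 1 p) r‖ ^ 2 : ℝ) : ℂ) := by
  have hs : star (kernelExponent p q) =
      -(1 / 2) * ((‖q.1 - p.1‖ ^ 2 + ‖q.2 - p.2‖ ^ 2 : ℝ) : ℂ) +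
        Complex.I * (inner ℝ (q.1 - p.1) (q.2 + p.2) : ℝ) := by
    simp [kernelExponent]
  have hp : pairing (toCn n 1 q - toCn n 1 p) (toCn n 1 p) =
      pairing (toCn n 1 q) (toCn n 1 p) - pairing (toCn n 1 p) (toCn n 1 p) := by
    simp [pairing, sub_mul, Finset.sum_sub_distrib]
  simp only [Pi.sub_apply]
  rw [sum_norm_sq_toCn_sub, hs, hp, pairing_toCn, pairing_self_toCn, flatExponent, flatExponent,
    norm_sub_sq_real, norm_sub_sq_real,
    inner_sub_left, inner_add_right, inner_add_right, real_inner_comm q.2 p.1]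
  push_cast
  ring

lemma two_rpow_half_sq : (((2 : ℝ) ^ ((n : ℝ) / 2) : ℝ) : ℂ) * (((2 : ℝ) ^ ((n : ℝ) / 2) : ℝ) : ℂ) =
    2 ^ n := by
  rw [← Complex.ofReal_mul, ← Real.rpow_add two_pos, add_halves, Real.rpow_natCast]
  norm_num

lemma norm_flatten_sq (f : (Fin n → ℂ) → ℂ) (q : R2 n) :
    ‖flatten n α f q‖ ^ 2 = 2 ^ n * Real.exp (-∑ r, ‖toCn n 1 q r‖ ^ 2) *
      ‖f ((Real.sqrt α)⁻¹ • toCn n 1 q)‖ ^ 2 := by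
  have e3 : ((2 : ℝ) ^ ((n : ℝ) / 2)) ^ 2 = 2 ^ n := by
    rw [← Real.rpow_natCast, ← Real.rpow_mul (by norm_num)]
    norm_num
  have e4 : ((2 : ℕ) : ℝ) * (flatExponent q).re = -(‖q.1‖ ^ 2 + ‖q.2‖ ^ 2) := by
    simp only [flatExponent, Complex.sub_re, Complex.mul_re, Complex.ofReal_re,
      Complex.ofReal_im, Complex.I_re, Complex.I_im]
    norm_num
    ring
  rw [flatten_apply, norm_mul, norm_mul, Complex.norm_exp, mul_pow, mul_pow, Complex.norm_real,
    Real.norm_eq_abs, sq_abs, e3, ← Real.exp_nat_mul, e4, sum_norm_sq_toCn, toCn_eq_smul]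

/-- The converse of `memLp_of_mem`; with it, square integrability may be checked after flattening.
-/
lemma memLp_gauss_of_memLp_flatten (hα : 0 < α) {f : (Fin n → ℂ) → ℂ} (hf : Continuous f)
    (h : MemLp (flatten n α f) 2 (flatMeasure n)) : MemLp f 2 (gaussMeasure n α) := by
  have hpi := Real.pi_pos
  have hsq := Real.sqrt_pos.2 hα
  rw [memLp_two_iff_integrable_sq_norm h.1] at h
  rw [memLp_two_iff_integrable_sq_norm hf.aestronglyMeasurable]
  unfold gaussMeasure
  rw [integrable_withDensity_iff (by fun_prop) (by simp)]
  unfold flatMeasure at h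
  rw [integrable_smul_measure (by simp only [ne_eq, ENNReal.ofReal_eq_zero, not_le]; positivity)
    ENNReal.ofReal_ne_top] at h
  simp_rw [norm_flatten_sq] at h
  have h1 : Integrable fun w : Fin n → ℂ => 2 ^ n * Real.exp (-∑ r, ‖w r‖ ^ 2) *
      ‖f ((Real.sqrt α)⁻¹ • w)‖ ^ 2 :=
    ((measurePreserving_toCn_one n).integrable_comp
      (Continuous.aestronglyMeasurable (by fun_prop))).1 h
  have h2 := h1.comp_smul (R := Real.sqrt α) hsq.ne'
  refine (h2.const_mul ((α / Real.pi) ^ n * (2 ^ n)⁻¹)).congr (ae_of_all _ fun w => ?_)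
  have e : ∑ r, ‖(Real.sqrt α • w) r‖ ^ 2 = α * ∑ r, ‖w r‖ ^ 2 := by
    simp only [Pi.smul_apply, norm_smul, mul_pow, Real.norm_eq_abs, sq_abs, Real.sq_sqrt hα.le,
      Finset.mul_sum]
  simp only [e, smul_smul, inv_mul_cancel₀ hsq.ne', one_smul]
  rw [ENNReal.toReal_ofReal (by positivity), neg_mul]
  field_simp

lemma memLp_flatKernel (hn : 1 ≤ n) (d : ℕ) (p : R2 n) :
    MemLp (flatKernel n d p) 2 (flatMeasure n) := by
  have hL := continuous_laguerre n d
  have hc : Continuous (flatKernel n d p) := by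
    unfold flatKernel kernelExponent
    fun_prop
  rw [memLp_two_iff_integrable_sq_norm hc.aestronglyMeasurable]
  refine Integrable.smul_measure ?_ ENNReal.ofReal_ne_top
  obtain ⟨P, hP⟩ := laguerre_eq_eval n d
  have h1 : Integrable fun w : Fin n → ℂ =>
      laguerre n d (∑ r, ‖w r‖ ^ 2) ^ 2 * Real.exp (-∑ r, ‖w r‖ ^ 2) := by
    refine integrable_radial hn (χ := fun s => laguerre n d s ^ 2 * Real.exp (-s)) ?_
    simp only [hP, ← Polynomial.eval_pow]
    exact integrableOn_pow_mul_eval_mul_exp (2 * n - 1) (P ^ 2)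
  have h2 := (h1.comp_sub_right (toCn n 1 p)).const_mul ((2 ^ n) ^ 2)
  refine (((measurePreserving_toCn_one n).integrable_comp h2.aestronglyMeasurable).2 h2).congr
    (ae_of_all _ fun q => ?_)
  have e4 : ((2 : ℕ) : ℝ) * (kernelExponent p q).re =
      -(‖q.1 - p.1‖ ^ 2 + ‖q.2 - p.2‖ ^ 2) := by
    simp only [kernelExponent, Complex.sub_re, Complex.mul_re, Complex.ofReal_re,
      Complex.ofReal_im, Complex.I_re, Complex.I_im]
    norm_num
    ring
  simp only [Function.comp_apply, Pi.sub_apply, sum_norm_sq_toCn_sub]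
  rw [flatKernel, norm_mul, norm_mul, Complex.norm_exp, mul_pow, mul_pow, Complex.norm_real,
    Real.norm_eq_abs, sq_abs, ← Real.exp_nat_mul, e4]
  simp
  ring

/-- The preimage of the kernel under the flattening operator. -/
def fockKernel (n d : ℕ) (α : ℝ) (p : R2 n) (w : Fin n → ℂ) : ℂ :=
  (((2 : ℝ) ^ ((n : ℝ) / 2) : ℝ) : ℂ) * Complex.exp (star (flatExponent p)) *
    (Complex.exp (pairing (Real.sqrt α • w) (toCn n 1 p)) *
      (laguerre n d (∑ r, ‖(Real.sqrt α • w) r - toCn n 1 p r‖ ^ 2) : ℂ))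

lemma flatten_fockKernel (hα : 0 < α) (d : ℕ) (p : R2 n) :
    flatten n α (fockKernel n d α p) = flatKernel n d p := by
  funext q
  have e : Real.sqrt α • toCn n α q = toCn n 1 q := by
    rw [toCn_eq_smul, smul_smul, mul_inv_cancel₀ (Real.sqrt_pos.2 hα).ne', one_smul]
  rw [flatten_apply, fockKernel, e, sum_norm_sq_toCn_sub, flatKernel, kernelExponent_eq,
    Complex.exp_add, Complex.exp_add, ← two_rpow_half_sq]
  ring

lemma PolyAnalytic.laguerre_sq_dist (d : ℕ) (z : Fin n → ℂ) :
    PolyAnalytic (d + 1) fun w : Fin n → ℂ => (laguerre n d (∑ r, ‖w r - z r‖ ^ 2) : ℂ) := by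
  have h : (fun w : Fin n → ℂ => (laguerre n d (∑ r, ‖w r - z r‖ ^ 2) : ℂ)) =
      ∑ i ∈ Finset.range (d + 1),
        (((-1) ^ i * ((d + n).choose (d - i) : ℝ) / (i.factorial : ℝ) : ℝ) : ℂ) •
          fun w : Fin n → ℂ => (((∑ r, ‖w r - z r‖ ^ 2) ^ i : ℝ) : ℂ) := by
    funext w
    simp only [laguerre, Finset.sum_apply, Pi.smul_apply, smul_eq_mul]
    rw [Complex.ofReal_sum]
    refine Finset.sum_congr rfl fun i _ => ?_
    push_cast
    ring
  rw [h]
  exact PolyAnalytic.sum _ fun i hi => ((PolyAnalytic.sq_dist_pow z i).const_smul _).mono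
    (Finset.mem_range.1 hi)

lemma polyAnalytic_fockKernel (d : ℕ) (α : ℝ) (p : R2 n) :
    PolyAnalytic (d + 1) (fockKernel n d α p) := by
  have h1 : PolyAnalytic (d + 1) ((fun w => Complex.exp (pairing w (toCn n 1 p))) *
      fun w : Fin n → ℂ => (laguerre n d (∑ r, ‖w r - toCn n 1 p r‖ ^ 2) : ℂ)) :=
    PolyAnalytic.holomorphic_mul (contDiff_pairing _).cexp (differentiable_pairing _).cexp
      (PolyAnalytic.laguerre_sq_dist d _)
  have h2 := (h1.comp_affine (Real.sqrt α) 0).const_smul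
    ((((2 : ℝ) ^ ((n : ℝ) / 2) : ℝ) : ℂ) * Complex.exp (star (flatExponent p)))
  convert! h2 using 1
  funext w
  simp [fockKernel]

lemma flatKernel_mem (hn : 1 ≤ n) (hα : 0 < α) (d : ℕ) (p : R2 n) :
    flatKernel n d p ∈ flatSubmodule n (d + 1) α := by
  refine ⟨fockKernel n d α p, ⟨isPolyanalytic_iff.2 (polyAnalytic_fockKernel d α p), ?_⟩,
    flatten_fockKernel hα d p⟩
  refine memLp_gauss_of_memLp_flatten hα (polyAnalytic_fockKernel d α p).contDiff.continuous ?_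
  rw [flatten_fockKernel hα]
  exact memLp_flatKernel hn d p

/-- The reproducing property in integral form. -/
theorem integral_star_flatKernel_mul (hn : 1 ≤ n) (hα : 0 < α) {d : ℕ} {g : R2 n → ℂ}
    (hg : g ∈ flatSubmodule n (d + 1) α) (p : R2 n) :
    ∫ q, star (flatKernel n d p q) * g q ∂(flatMeasure n) = g p := by
  have hmem := memLp_of_mem hα hg
  have hint : Integrable (fun q => star (flatKernel n d p q) * g q) (flatMeasure n) :=
    (memLp_flatKernel hn d p).star.integrable_mul hmem
  obtain ⟨f, ⟨hf, -⟩, rfl⟩ := hg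
  rw [isPolyanalytic_iff] at hf
  have hpi := Real.pi_pos
  have hfc := hf.contDiff.continuous
  have hL := continuous_laguerre n d
  set z := toCn n 1 p with hz
  set C : ℂ := 2 ^ n * ((((2 : ℝ) ^ ((n : ℝ) / 2) : ℝ) : ℂ) * Complex.exp (flatExponent p)) with hC
  -- `F` is `f` recentred at `p` and multiplied by the holomorphic factor left over from completing
  -- the square; `F 0` is the value of `f` at `toCn n α p`.
  let F : (Fin n → ℂ) → ℂ := fun w =>
    Complex.exp (-pairing w z) * f ((Real.sqrt α)⁻¹ • w + (Real.sqrt α)⁻¹ • z)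
  have hF : PolyAnalytic (d + 1) F :=
    PolyAnalytic.holomorphic_mul (contDiff_pairing z).neg.cexp (differentiable_pairing z).neg.cexp
      (hf.comp_affine _ _)
  have hFc := hF.contDiff.continuous
  let H : (Fin n → ℂ) → ℂ := fun w => F w *
    ((laguerre n d (∑ r, ‖w r‖ ^ 2) * Real.exp (-∑ r, ‖w r‖ ^ 2) : ℝ) : ℂ)
  have hHc : Continuous H := by fun_prop
  have e : (fun q => star (flatKernel n d p q) * flatten n α f q) =
      (fun w => C * H (w - z)) ∘ toCn n 1 := by
    funext q
    have e1 := star_kernelExponent_add p q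
    have e2 : star (flatKernel n d p q) = 2 ^ n * Complex.exp (star (kernelExponent p q)) *
        (laguerre n d (‖q.1 - p.1‖ ^ 2 + ‖q.2 - p.2‖ ^ 2) : ℂ) := by
      simp [flatKernel, ← Complex.exp_conj]
    have e3 : Complex.exp (star (kernelExponent p q)) * Complex.exp (flatExponent q) =
        Complex.exp (flatExponent p) * Complex.exp (-pairing (toCn n 1 q - z) z) *
          Complex.exp (-((∑ r, ‖(toCn n 1 q - z) r‖ ^ 2 : ℝ) : ℂ)) := by
      rw [← Complex.exp_add, e1, ← Complex.exp_add, ← Complex.exp_add]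
      congr 1
    have e4 : (Real.sqrt α)⁻¹ • (toCn n 1 q - z) + (Real.sqrt α)⁻¹ • z = toCn n α q := by
      rw [← smul_add, sub_add_cancel, ← toCn_eq_smul]
    have e5 : ∑ r, ‖(toCn n 1 q - z) r‖ ^ 2 = ‖q.1 - p.1‖ ^ 2 + ‖q.2 - p.2‖ ^ 2 := by
      rw [← sum_norm_sq_toCn_sub]
      rfl
    simp only [Function.comp_apply, H, F]
    rw [e5] at e3
    rw [e2, flatten_apply, e4, hC, e5]
    push_cast at e3 ⊢
    linear_combination (2 ^ n * (laguerre n d (‖q.1 - p.1‖ ^ 2 + ‖q.2 - p.2‖ ^ 2) : ℂ) *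
      (((2 : ℝ) ^ ((n : ℝ) / 2) : ℝ) : ℂ) * f (toCn n α q)) * e3
  have h0 : ENNReal.ofReal (((2 * Real.pi) ^ n)⁻¹) ≠ 0 := by
    simp only [ne_eq, ENNReal.ofReal_eq_zero, not_le]
    positivity
  have hmeas : AEStronglyMeasurable (fun w => C * H (w - z)) (volume : Measure (Fin n → ℂ)) :=
    Continuous.aestronglyMeasurable (by fun_prop)
  have hC0 : C ≠ 0 := by
    rw [hC]
    refine mul_ne_zero (by simp) (mul_ne_zero ?_ (Complex.exp_ne_zero _))
    exact_mod_cast (Real.rpow_pos_of_pos two_pos _).ne'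
  rw [e] at hint
  unfold flatMeasure at hint ⊢
  rw [integrable_smul_measure h0 ENNReal.ofReal_ne_top,
    (measurePreserving_toCn_one n).integrable_comp hmeas] at hint
  -- The integrand is a product of two `L²` functions; undoing the translation and the nonzero
  -- constant `C` gives integrability of `H`.
  have hHi : Integrable H := by
    have h1 := (hint.const_mul C⁻¹).comp_add_right z
    refine h1.congr (ae_of_all _ fun w => ?_)
    simp only [add_sub_cancel_right]
    rw [inv_mul_cancel_left₀ hC0]
  rw [integral_smul_measure, e]
  have h2 : ∫ q : R2 n, ((fun w => C * H (w - z)) ∘ toCn n 1) q = ∫ w, C * H (w - z) := by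
    have hm := (measurePreserving_toCn_one n).map_eq
    conv_rhs => rw [← hm]
    rw [integral_map (measurePreserving_toCn_one n).measurable.aemeasurable (by rwa [hm])]
    rfl
  rw [h2, integral_const_mul, integral_sub_right_eq_self H z, hF.integral_mul_laguerre hn hHi,
    ENNReal.toReal_ofReal (by positivity)]
  have h3 : F 0 = f (toCn n α p) := by
    simp [F, pairing, toCn_eq_smul (α := α) p, hz]
  rw [h3, flatten_apply, hC, Complex.real_smul]
  have : (Real.pi : ℂ) ≠ 0 := by exact_mod_cast hpi.ne'
  push_cast
  rw [mul_pow]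
  field_simp

end PolyFock

end

/-! ### Hilbert space structure, completeness and dimension count -/

noncomputable section

namespace PolyFock

variable {n d : ℕ} {α : ℝ}

namespace FlatSpace

variable {m : ℕ} {hα : 0 < α}

lemma inner_eq_integral (g h : FlatSpace n m α hα) :
    inner ℂ g h = ∫ q, star (g.toFun q) * h.toFun q ∂(flatMeasure n) := by
  change inner ℂ (toL2 g) (toL2 h) = _
  rw [L2.inner_def]
  refine integral_congr_ae ?_
  filter_upwards [(memLp_of_mem hα g.2).coeFn_toLp, (memLp_of_mem hα h.2).coeFn_toLp] with q h1 h2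
  have e1 : (toL2 g) q = g.toFun q := h1
  have e2 : (toL2 h) q = h.toFun q := h2
  rw [e1, e2, RCLike.inner_apply, mul_comm]
  rfl

lemma isometry_toL2 : Isometry (toL2 : FlatSpace n m α hα →ₗ[ℂ] Lp ℂ 2 (flatMeasure n)) :=
  AddMonoidHomClass.isometry_of_norm _ fun _ => rfl

/-- The kernel at `p` as an element of the flattened space. -/
def kernelAt (hn : 1 ≤ n) (d : ℕ) (hα : 0 < α) (p : R2 n) : FlatSpace n (d + 1) α hα :=
  ⟨flatKernel n d p, flatKernel_mem hn hα d p⟩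

lemma inner_kernelAt (hn : 1 ≤ n) (g : FlatSpace n (d + 1) α hα) (p : R2 n) :
    inner ℂ (kernelAt hn d hα p) g = g.toFun p := by
  rw [inner_eq_integral]
  exact integral_star_flatKernel_mul hn hα g.2 p

/-- The reproducing property applied to the kernel itself gives `‖K_p‖² = K_p(p)`, where the
exponent vanishes and `L_d^{(n)}(0)` remains. -/
lemma norm_kernelAt (hn : 1 ≤ n) (p : R2 n) :
    ‖kernelAt hn d hα p‖ = Real.sqrt (2 ^ n * ((d + n).choose d : ℝ)) := by
  have h := inner_kernelAt hn (kernelAt hn d hα p) p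
  rw [inner_self_eq_norm_sq_to_K] at h
  have hL : laguerre n d 0 = ((d + n).choose d : ℝ) := by
    rw [laguerre, Finset.sum_range_succ']
    simp
  have h2 : (kernelAt hn d hα p).toFun p = ((2 ^ n * ((d + n).choose d : ℝ) : ℝ) : ℂ) := by
    change flatKernel n d p p = _
    simp [flatKernel, kernelExponent, hL]
  rw [h2] at h
  have h3 : ‖kernelAt hn d hα p‖ ^ 2 = 2 ^ n * ((d + n).choose d : ℝ) := by
    apply Complex.ofReal_injective
    rw [← h, Complex.ofReal_pow]
    rfl
  rw [← h3, Real.sqrt_sq (norm_nonneg _)]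

lemma norm_toFun_le (hn : 1 ≤ n) (g : FlatSpace n (d + 1) α hα) (p : R2 n) :
    ‖g.toFun p‖ ≤ Real.sqrt (2 ^ n * ((d + n).choose d : ℝ)) * ‖g‖ := by
  rw [← inner_kernelAt hn, ← norm_kernelAt hn p]
  exact norm_inner_le_norm _ _

end FlatSpace

/-- The inverse of `(x, y) ↦ (x + i y) / √α`. -/
def ofCn (n : ℕ) (α : ℝ) (w : Fin n → ℂ) : R2 n :=
  (WithLp.toLp 2 fun r => Real.sqrt α * (w r).re, WithLp.toLp 2 fun r => Real.sqrt α * (w r).im)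

lemma toCn_ofCn (hα : 0 < α) (w : Fin n → ℂ) : toCn n α (ofCn n α w) = w := by
  funext r
  have h : (Real.sqrt α : ℂ) ≠ 0 := by exact_mod_cast (Real.sqrt_pos.2 hα).ne'
  simp only [toCn, ofCn]
  rw [div_eq_iff h]
  conv_rhs => rw [← Complex.re_add_im (w r)]
  push_cast
  ring

lemma ofCn_toCn (hα : 0 < α) (p : R2 n) : ofCn n α (toCn n α p) = p := by
  have h := (Real.sqrt_pos.2 hα).ne'
  have e : ∀ r, toCn n α p r = ((p.1 r / Real.sqrt α : ℝ) : ℂ) +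
      ((p.2 r / Real.sqrt α : ℝ) : ℂ) * Complex.I := by
    intro r
    simp [toCn]
    ring
  refine Prod.ext ?_ ?_ <;> ext r
  · simp only [ofCn, e, Complex.add_re, Complex.ofReal_re, Complex.re_ofReal_mul, Complex.I_re]
    field_simp
    ring
  · simp only [ofCn, e, Complex.add_im, Complex.ofReal_im, Complex.im_ofReal_mul, Complex.I_im]
    field_simp
    ring

lemma continuous_ofCn (n : ℕ) (α : ℝ) : Continuous (ofCn n α) := by
  unfold ofCn
  refine Continuous.prodMk ?_ ?_ <;>
  · refine (PiLp.continuous_toLp 2 _).comp ?_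
    fun_prop

/-- The inverse of the flattening operator. -/
def unflatten (n : ℕ) (α : ℝ) (g : R2 n → ℂ) (w : Fin n → ℂ) : ℂ :=
  ((((2 : ℝ) ^ ((n : ℝ) / 2) : ℝ) : ℂ) * Complex.exp (flatExponent (ofCn n α w)))⁻¹ *
    g (ofCn n α w)

lemma two_rpow_mul_exp_ne_zero (q : R2 n) :
    (((2 : ℝ) ^ ((n : ℝ) / 2) : ℝ) : ℂ) * Complex.exp (flatExponent q) ≠ 0 :=
  mul_ne_zero (by exact_mod_cast (Real.rpow_pos_of_pos two_pos _).ne') (Complex.exp_ne_zero _)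

lemma unflatten_flatten (hα : 0 < α) (f : (Fin n → ℂ) → ℂ) :
    unflatten n α (flatten n α f) = f := by
  funext w
  rw [unflatten, flatten_apply, toCn_ofCn hα, inv_mul_cancel_left₀ (two_rpow_mul_exp_ne_zero _)]

lemma flatten_unflatten (hα : 0 < α) (g : R2 n → ℂ) : flatten n α (unflatten n α g) = g := by
  funext p
  rw [flatten_apply, unflatten, ofCn_toCn hα, mul_inv_cancel_left₀ (two_rpow_mul_exp_ne_zero _)]

lemma continuous_unflatten_factor (n : ℕ) (α : ℝ) : Continuous fun w : Fin n → ℂ =>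
    ((((2 : ℝ) ^ ((n : ℝ) / 2) : ℝ) : ℂ) * Complex.exp (flatExponent (ofCn n α w)))⁻¹ := by
  refine Continuous.inv₀ ?_ fun w => two_rpow_mul_exp_ne_zero _
  have h := continuous_ofCn n α
  have h2 : Continuous (flatExponent (n := n)) := by
    unfold flatExponent
    fun_prop
  fun_prop

lemma continuous_unflatten {g : R2 n → ℂ} (hg : Continuous g) : Continuous (unflatten n α g) :=
  (continuous_unflatten_factor n α).mul (hg.comp (continuous_ofCn n α))

/-- Uniform limits of functions of the flattened space that are square integrable belong to it. -/
lemma mem_flatSubmodule_of_tendstoUniformly (hn : 1 ≤ n) {m : ℕ} (hα : 0 < α)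
    {g : ℕ → R2 n → ℂ} {G : R2 n → ℂ} (hg : ∀ k, g k ∈ flatSubmodule n m α)
    (hG : MemLp G 2 (flatMeasure n)) (hlim : TendstoUniformly g G Filter.atTop) :
    G ∈ flatSubmodule n m α := by
  have hGc : Continuous G := hlim.continuous (.of_forall fun k => continuous_of_mem (hg k))
  have hc := continuous_unflatten (α := α) hGc
  refine ⟨unflatten n α G, ⟨isPolyanalytic_iff.2 ?_, ?_⟩, flatten_unflatten hα G⟩
  · refine PolyAnalytic.of_tendstoUniformlyOn hn (f := fun k => unflatten n α (g k)) (fun k => ?_)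
      hc fun K hK => ?_
    · obtain ⟨f, ⟨hf, -⟩, hfg⟩ := hg k
      rw [← hfg, unflatten_flatten hα]
      exact isPolyanalytic_iff.1 hf
    -- Unflattening multiplies by a factor that is bounded on compact sets, which turns uniform
    -- convergence into locally uniform convergence.
    · obtain ⟨M, hM⟩ := hK.exists_bound_of_continuousOn
        (continuous_unflatten_factor n α).continuousOn
      rw [Metric.tendstoUniformlyOn_iff]
      intro ε hε
      have hδ : 0 < ε / (|M| + 1) := by positivity
      filter_upwards [Metric.tendstoUniformly_iff.1 hlim _ hδ] with k hk w hw
      have h1 := hk (ofCn n α w)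
      rw [dist_eq_norm] at h1 ⊢
      rw [unflatten, unflatten, ← mul_sub, norm_mul]
      calc _ ≤ |M| * (ε / (|M| + 1)) :=
            mul_le_mul ((hM w hw).trans (le_abs_self M)) h1.le (norm_nonneg _) (abs_nonneg M)
        _ < ε := by
            rw [mul_div_assoc', div_lt_iff₀ (by positivity)]
            nlinarith [abs_nonneg M]
  · refine memLp_gauss_of_memLp_flatten hα hc ?_
    rwa [flatten_unflatten hα]

namespace FlatSpace

variable {hα : 0 < α}

/-- The norm dominates the supremum norm, so a Cauchy sequence has both a uniform limit and an `L²`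
limit. They agree almost everywhere along a subsequence, and the uniform limit belongs to the space.
-/
theorem completeSpace (hn : 1 ≤ n) (d : ℕ) (hα : 0 < α) :
    CompleteSpace (FlatSpace n (d + 1) α hα) := by
  refine Metric.complete_of_cauchySeq_tendsto fun g hg => ?_
  have hcauchy : CauchySeq fun k => toL2 (g k) := hg.map isometry_toL2.uniformContinuous
  obtain ⟨h, hh⟩ := cauchySeq_tendsto_of_complete hcauchy
  set A := Real.sqrt (2 ^ n * ((d + n).choose d : ℝ)) with hA
  have hdist : ∀ j k p, dist ((g j).toFun p) ((g k).toFun p) ≤ A * dist (g j) (g k) := by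
    intro j k p
    rw [dist_eq_norm, dist_eq_norm]
    exact norm_toFun_le hn (g j - g k) p
  have hu : UniformCauchySeqOn (fun k => (g k).toFun) Filter.atTop Set.univ := by
    rw [Metric.uniformCauchySeqOn_iff]
    intro ε hε
    have hA0 : 0 ≤ A := Real.sqrt_nonneg _
    obtain ⟨N, hN⟩ := Metric.cauchySeq_iff.1 hg (ε / (A + 1)) (by positivity)
    refine ⟨N, fun j hj k hk p _ => (hdist j k p).trans_lt ?_⟩
    calc A * dist (g j) (g k) ≤ A * (ε / (A + 1)) :=
          mul_le_mul_of_nonneg_left (hN j hj k hk).le hA0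
      _ < ε := by
          rw [mul_div_assoc', div_lt_iff₀ (by positivity)]
          nlinarith
  have hpt : ∀ p, ∃ c, Filter.Tendsto (fun k => (g k).toFun p) Filter.atTop (nhds c) := fun p =>
    cauchySeq_tendsto_of_complete (hu.cauchySeq (Set.mem_univ p))
  choose G hG using hpt
  have hunif : TendstoUniformly (fun k => (g k).toFun) G Filter.atTop := by
    rw [← tendstoUniformlyOn_univ]
    exact hu.tendstoUniformlyOn_of_tendsto fun p _ => hG p
  have hae : h =ᵐ[flatMeasure n] G := by
    obtain ⟨ns, hns, hlim⟩ :=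
      (tendstoInMeasure_of_tendsto_Lp hh).exists_seq_tendsto_ae
    have hcoe : ∀ᵐ p ∂(flatMeasure n), ∀ k, (toL2 (g k)) p = (g k).toFun p :=
      ae_all_iff.2 fun k => (memLp_of_mem hα (g k).2).coeFn_toLp
    filter_upwards [hlim, hcoe] with p h1 h2
    simp only [h2] at h1
    exact tendsto_nhds_unique h1 ((hG p).comp hns.tendsto_atTop)
  have hGmem : MemLp G 2 (flatMeasure n) := (memLp_congr_ae hae).1 (Lp.memLp h)
  let G' : FlatSpace n (d + 1) α hα :=
    ⟨G, mem_flatSubmodule_of_tendstoUniformly hn hα (fun k => (g k).2) hGmem hunif⟩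
  have hG' : toL2 G' = h := by
    refine Lp.ext ?_
    exact (memLp_of_mem hα G'.2).coeFn_toLp.trans hae.symm
  refine ⟨G', ?_⟩
  rw [isometry_toL2.isEmbedding.tendsto_nhds_iff, hG']
  exact hh

/-- The flattened space is a space of functions with continuous point evaluations. -/
@[reducible]
def rkhs (hn : 1 ≤ n) (d : ℕ) (hα : 0 < α) :
    RKHS ℂ (FlatSpace n (d + 1) α hα) (R2 n) ℂ where
  coeCLM :=
    { toFun := toFun
      map_add' := fun _ _ => rfl
      map_smul' := fun _ _ => rfl
      cont := by
        refine continuous_pi fun p => ?_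
        have h : (fun g : FlatSpace n (d + 1) α hα => g.toFun p) =
            fun g => inner ℂ (kernelAt hn d hα p) g := funext fun g => (inner_kernelAt hn g p).symm
        rw [h]
        fun_prop }
  coeCLM_injective := fun _ _ h => Subtype.ext h

end FlatSpace

/-- A slack coordinate `d - |k|` turns the inequality into an equality in `n + 1` variables; then
stars and bars. -/
lemma dim_eq_choose (n d : ℕ) : dim n (d + 1) = (n + (d + 1) - 1).choose n := by
  let e : {k : Fin n → ℕ // ∑ r, k r < d + 1} ≃ {P : Fin (n + 1) → ℕ // ∑ i, P i = d} :=
    { toFun := fun k => ⟨(Fin.cons (d - ∑ r, k.1 r) k.1 : Fin (n + 1) → ℕ), by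
        have := k.2
        rw [Fin.sum_cons]
        omega⟩
      invFun := fun P => ⟨fun r => P.1 r.succ, by
        have := P.2
        rw [Fin.sum_univ_succ] at this
        change ∑ r : Fin n, P.1 r.succ < d + 1
        omega⟩
      left_inv := fun k => Subtype.ext (by
        funext r
        simp)
      right_inv := fun P => Subtype.ext (by
        have := P.2
        rw [Fin.sum_univ_succ] at this
        funext i
        refine Fin.cases ?_ (fun r => ?_) i
        · simp only [Fin.cons_zero]
          omega
        · simp) }
  rw [dim, Nat.card_congr (e.trans (Sym.equivNatSumOfFintype (Fin (n + 1)) d).symm),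
    Nat.card_eq_fintype_card, Sym.card_sym_eq_choose, Fintype.card_fin,
    show n + 1 + d - 1 = n + d by omega, show n + (d + 1) - 1 = n + d by omega,
    Nat.choose_symm_add]

end PolyFock

end

theorem mainTheorem5 (n m : ℕ) (hn : 1 ≤ n) (hm : 1 ≤ m) (α : ℝ) (hα : 0 < α) :
    ∃ (_ : CompleteSpace (PolyFock.FlatSpace n m α hα))
      (_ : RKHS ℂ (PolyFock.FlatSpace n m α hα) (PolyFock.R2 n) ℂ),
      -- the functions of the RKHS are the elements of the flattened space themselves
      (∀ g : PolyFock.FlatSpace n m α hα, RKHS.coeCLM ℂ g = g.toFun) ∧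
      (∀ x y u v : EuclideanSpace ℝ (Fin n),
        (RKHS.kerFun (PolyFock.FlatSpace n m α hα) (x, y) 1).toFun (u, v) =
          2 ^ n *
            Complex.exp (-(1 / 2) * ((‖u - x‖ ^ 2 + ‖v - y‖ ^ 2 : ℝ) : ℂ)
              - Complex.I * (inner ℝ (u - x) (v + y) : ℝ)) *
            (PolyFock.laguerre n (m - 1) (‖u - x‖ ^ 2 + ‖v - y‖ ^ 2) : ℂ)) ∧
      (∀ x y : EuclideanSpace ℝ (Fin n),
        ‖RKHS.kerFun (PolyFock.FlatSpace n m α hα) (x, y) 1‖ =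
          Real.sqrt (2 ^ n * (PolyFock.dim n m : ℝ))) ∧
      PolyFock.dim n m = (n + m - 1).choose n ∧
      (∀ a x y u v : EuclideanSpace ℝ (Fin n),
        (RKHS.kerFun (PolyFock.FlatSpace n m α hα) (x + a, y) 1).toFun (u + a, v) =
          (RKHS.kerFun (PolyFock.FlatSpace n m α hα) (x, y) 1).toFun (u, v)) := by
  obtain ⟨d, rfl⟩ : ∃ d, m = d + 1 := ⟨m - 1, by omega⟩
  have hcomplete := PolyFock.FlatSpace.completeSpace hn d hα
  let _ := PolyFock.FlatSpace.rkhs hn d hα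
  have hker : ∀ p : PolyFock.R2 n, RKHS.kerFun (PolyFock.FlatSpace n (d + 1) α hα) p 1 =
      PolyFock.FlatSpace.kernelAt hn d hα p := by
    intro p
    -- Both vectors represent evaluation at `p`, so they have the same inner product with every `g`.
    refine ext_inner_right ℂ fun g => ?_
    rw [RKHS.kerFun_inner, PolyFock.FlatSpace.inner_kernelAt]
    change inner ℂ (1 : ℂ) (g.toFun p) = g.toFun p
    simp
  refine ⟨hcomplete, inferInstance, fun g => rfl, fun x y u v => ?_, fun x y => ?_,
    PolyFock.dim_eq_choose n d, fun a x y u v => ?_⟩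
  · rw [hker]
    rfl
  · rw [hker, PolyFock.FlatSpace.norm_kernelAt, PolyFock.dim_eq_choose,
      show n + (d + 1) - 1 = d + n by omega, Nat.choose_symm_add]
  · rw [hker, hker]
    change PolyFock.flatKernel n d (x + a, y) (u + a, v) = PolyFock.flatKernel n d (x, y) (u, v)
    simp only [PolyFock.flatKernel, PolyFock.kernelExponent, add_sub_add_right_eq_sub]
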